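/- Let $d\ge 1$ and let $\mathcal M_d$ be the algebra of complex $d\times d$ matrices. Let $\mathcal L:\mathcal M_d\to\mathcal M_d$ be a Liouvillian, i.e. $\mathcal L(f)=i[H,f]+\sum_{i=1}^m\big(L_i^\dagger fL_i-\tfrac12\{L_i^\dagger L_i,f\}\big)$ for some Hermitian $H$ and finitely many $L_i\in\mathcal M_d$, and let $\mathcal L^*$ be its dual with respect to the Hilbert–Schmidt inner product $\mathrm{tr}(X^\dagger Y)$. A state is a positive semidefinite matrix of trace one. Assume that $\mathcal L$ is primitive: there is exactly one state $\sigma$ with $\mathcal L^*(\sigma)=0$, and $\sigma$ has full rank. Put $\Gamma_\sigma(f)=\sigma^{1/2}f\sigma^{1/2}$, $\hat{\mathcal L}=\Gamma_\sigma^{-1}\circ\mathcal L^*\circ\Gamma_\sigma$, and, for Hermitian $g$ and positive definite $f$, $$\mathrm{Var}_\sigma(g)=\mathrm{tr}(\Gamma_\sigma(g)g)-\big(\mathrm{tr}\,\Gamma_\sigma(g)\big)^2,\qquad \hat{\mathcal E}_2(g)=-\mathrm{tr}\big(\Gamma_\sigma(g)\,\hat{\mathcal L}(g)\big),$$ $$\mathrm{Ent}_1(f)=\mathrm{tr}\big(\Gamma_\sigma(f)(\log\Gamma_\sigma(f)-\log\sigma)\big)-\mathrm{tr}\,\Gamma_\sigma(f)\,\log\mathrm{tr}\,\Gamma_\sigma(f),$$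 $$\hat{\mathcal E}_1(f)=-\tfrac12\,\mathrm{tr}\big(\Gamma_\sigma(\hat{\mathcal L}(f))(\log\Gamma_\sigma(f)-\log\sigma)\big).$$ Let $\sigma_{\min}$ be the smallest eigenvalue of $\sigma$, and let $\|A\|_{\mathrm{tr}}=\mathrm{tr}\sqrt{A^\dagger A}$. For a state $\rho$ put $\rho_t=e^{t\mathcal L^*}(\rho)$. 1. ($\chi^2$ bound) If $\lambda\in\mathbb R$ and $\lambda\,\mathrm{Var}_\sigma(g)\le\hat{\mathcal E}_2(g)$ for all Hermitian $g\in\mathcal M_d$, then for every state $\rho$ and every $t\ge 0$, $$\|\rho_t-\sigma\|_{\mathrm{tr}}\le\sqrt{1/\sigma_{\min}}\;e^{-\lambda t}.$$ 2. (Log-Sobolev bound) If $\alpha_1\in\mathbb R$ and $\alpha_1\,\mathrm{Ent}_1(f)\le\hat{\mathcal E}_1(f)$ for all positive definite $f\in\mathcal M_d$, then for every state $\rho$ and every $t\ge 0$, $$\|\rho_t-\sigma\|_{\mathrm{tr}}\le\sqrt{2\log(1/\sigma_{\min})}\;e^{-\alpha_1 t}.$$ -/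

import Mathlib

open scoped ComplexOrder

noncomputable section

namespace QMix

open Matrix

/-- The algebra of complex `d × d` matrices. -/
abbrev Mat (d : ℕ) : Type := Matrix (Fin d) (Fin d) ℂ

/-- States: positive semidefinite matrices of trace one. -/
def IsState {d : ℕ} (ρ : Mat d) : Prop :=
  ρ.PosSemidef ∧ ρ.trace = 1

/-- The Lindblad generator in the Heisenberg picture with Hamiltonian `H` and Lindblad
operators `K`:  `f ↦ i[H, f] + ∑ i, (Kᵢ† f Kᵢ - ½ {Kᵢ† Kᵢ, f})`. -/
def lindblad {d m : ℕ} (H : Mat d) (K : Fin m → Mat d) (f : Mat d) : Mat d :=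
  Complex.I • (H * f - f * H) +
    ∑ i, ((K i)ᴴ * f * K i - (1 / 2 : ℂ) • ((K i)ᴴ * K i * f + f * ((K i)ᴴ * K i)))

/-- A Liouvillian: a linear map that has Lindblad form for some Hermitian Hamiltonian and some
finite family of Lindblad operators. -/
def IsLiouvillian {d : ℕ} (L : Mat d →ₗ[ℂ] Mat d) : Prop :=
  ∃ (m : ℕ) (H : Mat d) (K : Fin m → Mat d), H.IsHermitian ∧ ∀ f, L f = lindblad H K f

/-- The dual `L*` of `L` with respect to the Hilbert-Schmidt inner product `tr (X† Y)`,
given by its entries `(L* ρ)ᵢⱼ = tr (L(Eᵢⱼ)† ρ)`. -/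
def hsDual {d : ℕ} (L : Mat d →ₗ[ℂ] Mat d) : Mat d →ₗ[ℂ] Mat d where
  toFun ρ := Matrix.of fun i j => ((L (Matrix.single i j 1))ᴴ * ρ).trace
  map_add' ρ τ := by
    ext i j
    simp [mul_add]
  map_smul' c ρ := by
    ext i j
    simp

/-- The defining property of the dual. -/
theorem trace_conjTranspose_mul_hsDual {d : ℕ} (L : Mat d →ₗ[ℂ] Mat d) (X Y : Mat d) :
    (Xᴴ * hsDual L Y).trace = ((L X)ᴴ * Y).trace := by
  have hX : X = ∑ i, ∑ j, X i j • Matrix.single i j (1 : ℂ) := by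
    conv_lhs => rw [Matrix.matrix_eq_sum_single X]
    simp [Matrix.smul_single]
  have h1 : ((L X)ᴴ * Y).trace
      = ∑ i, ∑ j, star (X i j) * ((L (Matrix.single i j 1))ᴴ * Y).trace := by
    conv_lhs => rw [hX]
    simp only [map_sum, map_smul, Matrix.conjTranspose_sum, Matrix.conjTranspose_smul,
      Finset.sum_mul, Matrix.smul_mul, Matrix.trace_sum, Matrix.trace_smul, smul_eq_mul]
  rw [h1, Finset.sum_comm]
  simp [Matrix.trace, Matrix.mul_apply, hsDual]

/-- A stationary state: a state `ρ` with `L* ρ = 0`. -/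
def IsStationaryState {d : ℕ} (L : Mat d →ₗ[ℂ] Mat d) (ρ : Mat d) : Prop :=
  IsState ρ ∧ hsDual L ρ = 0

/-- A Liouvillian is primitive if it has a unique stationary state and this state has
full rank. -/
def IsPrimitive {d : ℕ} (L : Mat d →ₗ[ℂ] Mat d) : Prop :=
  ∃ σ : Mat d, IsStationaryState L σ ∧ σ.PosDef ∧ ∀ τ, IsStationaryState L τ → τ = σ

/-- The evolution of states (Schroedinger picture)
`ρ_t = exp (t L*) ρ = ∑ n, (tⁿ / n!) (L*)ⁿ ρ`. -/
def evolve {d : ℕ} (L : Mat d →ₗ[ℂ] Mat d) (t : ℝ) (ρ : Mat d) : Mat d :=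
  ∑' n : ℕ, ((t : ℂ) ^ n / (n.factorial : ℂ)) • ((hsDual L) ^ n) ρ

theorem summable_exp_series {E : Type*} [NormedAddCommGroup E] [NormedSpace ℂ E]
    [FiniteDimensional ℂ E] (A : E →ₗ[ℂ] E) (t : ℂ) (x : E) :
    Summable fun n : ℕ => (t ^ n / (n.factorial : ℂ)) • (A ^ n) x := by
  set B : E →L[ℂ] E := LinearMap.toContinuousLinearMap A with hB
  have hA : ∀ n : ℕ, ‖(A ^ n) x‖ ≤ ‖B‖ ^ n * ‖x‖ := by
    intro n
    induction n with
    | zero => simp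
    | succ k ih =>
      rw [pow_succ']
      calc ‖(A * A ^ k) x‖ = ‖B ((A ^ k) x)‖ := rfl
        _ ≤ ‖B‖ * ‖(A ^ k) x‖ := B.le_opNorm _
        _ ≤ ‖B‖ * (‖B‖ ^ k * ‖x‖) := by gcongr
        _ = ‖B‖ ^ (k + 1) * ‖x‖ := by ring
  refine Summable.of_norm_bounded
    (g := fun n : ℕ => ((‖t‖ * ‖B‖) ^ n / (n.factorial : ℝ)) * ‖x‖)
    ((Real.summable_pow_div_factorial _).mul_right _) ?_
  intro n
  rw [norm_smul, norm_div, norm_pow, Complex.norm_natCast, mul_pow]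
  calc ‖t‖ ^ n / (n.factorial : ℝ) * ‖(A ^ n) x‖
      ≤ ‖t‖ ^ n / (n.factorial : ℝ) * (‖B‖ ^ n * ‖x‖) := by gcongr; exact hA n
    _ = _ := by ring

/-- The exponential series defining the evolution converges. -/
theorem hasSum_evolve {d : ℕ} (L : Mat d →ₗ[ℂ] Mat d) (t : ℝ) (ρ : Mat d) :
    HasSum (fun n : ℕ => ((t : ℂ) ^ n / (n.factorial : ℂ)) • ((hsDual L) ^ n) ρ)
      (evolve L t ρ) :=
  (summable_exp_series (E := Fin d → Fin d → ℂ) (hsDual L) (t : ℂ) ρ).hasSum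

/-- The square root of a positive semidefinite matrix, by functional calculus. -/
def msqrt {d : ℕ} (A : Mat d) : Mat d := cfc Real.sqrt A

/-- The logarithm of a positive definite matrix, by functional calculus. -/
def mlog {d : ℕ} (A : Mat d) : Mat d := cfc Real.log A

/-- The trace norm `tr |A|`, where `|A| = (A† A)^(1/2)`. -/
def trNorm {d : ℕ} (A : Mat d) : ℝ := (msqrt (Aᴴ * A)).trace.re

/-- The weighting map `Γ_σ (f) = σ^(1/2) f σ^(1/2)`. -/
def gam {d : ℕ} (σ : Mat d) : Mat d →ₗ[ℂ] Mat d :=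
  LinearMap.mulLeftRight ℂ (msqrt σ, msqrt σ)

/-- The inverse weighting map `Γ_σ⁻¹ (f) = σ^(-1/2) f σ^(-1/2)`, for `σ` of full rank. -/
def gamInv {d : ℕ} (σ : Mat d) : Mat d →ₗ[ℂ] Mat d :=
  LinearMap.mulLeftRight ℂ ((msqrt σ)⁻¹, (msqrt σ)⁻¹)

/-- The generator of the dynamics of relative densities, `L̂ = Γ_σ⁻¹ ∘ L* ∘ Γ_σ`: the dual of
`L` with respect to the `σ`-weighted inner product. -/
def hatGen {d : ℕ} (L : Mat d →ₗ[ℂ] Mat d) (σ : Mat d) : Mat d →ₗ[ℂ] Mat d :=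
  gamInv σ ∘ₗ hsDual L ∘ₗ gam σ

/-- The variance `Var_σ (g) = tr (Γ_σ(g) g) - (tr Γ_σ(g))²`, which is real for Hermitian `g`. -/
def variance {d : ℕ} (σ g : Mat d) : ℝ :=
  (gam σ g * g).trace.re - (gam σ g).trace.re ^ 2

/-- The `L₁` relative entropy
`Ent₁ (f) = tr (Γ_σ(f) (log Γ_σ(f) - log σ)) - tr Γ_σ(f) log (tr Γ_σ(f))`, for positive
definite `f` (and then real). -/
def ent1 {d : ℕ} (σ f : Mat d) : ℝ :=
  (gam σ f * (mlog (gam σ f) - mlog σ)).trace.re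
    - (gam σ f).trace.re * Real.log (gam σ f).trace.re

/-- The `L₂` Dirichlet form of a generator `G`: `-⟨f, G f⟩_σ = -tr (Γ_σ(f) G(f))`. -/
def dirichlet2 {d : ℕ} (σ : Mat d) (G : Mat d →ₗ[ℂ] Mat d) (f : Mat d) : ℝ :=
  -(gam σ f * G f).trace.re

/-- The `L₁` Dirichlet form of a generator `G`:
`-½ tr (Γ_σ(G f) (log Γ_σ(f) - log σ))`. -/
def dirichlet1 {d : ℕ} (σ : Mat d) (G : Mat d →ₗ[ℂ] Mat d) (f : Mat d) : ℝ :=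
  -(1 / 2) * (gam σ (G f) * (mlog (gam σ f) - mlog σ)).trace.re

/-- The smallest eigenvalue of a Hermitian matrix. -/
def minEig {d : ℕ} {A : Mat d} (hA : A.IsHermitian) : ℝ := ⨅ i, hA.eigenvalues i

end QMix

end

/-!
Both bounds follow one scheme. Write `ρ_t = Γ_σ(f_t)`. A divergence of `ρ_t` from `σ` dominates the
squared trace norm of `ρ_t - σ`, its time derivative is `-2` times the Dirichlet form at `f_t`, and
its initial value is controlled by `σ_min`; the assumed functional inequality at `f_t` and Gronwall's
lemma (`le_exp_mul_of_hasDerivAt`) do the rest.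

For the first bound the divergence is `χ²`, that is `tr (ρ_t Γ_σ⁻¹(ρ_t)) - 1 = Var_σ(f_t)`. It is a
quadratic function of `ρ_t`, and `sq_trNorm_le_trace_mul_gamInv` compares it with the trace norm by
the Cauchy–Schwarz inequality in an eigenbasis of `σ`.

For the second bound it is the relative entropy `tr (ρ_t (log ρ_t - log σ)) = Ent₁(f_t)`.
`sq_trace_mul_sub_le` is the quantum Pinsker inequality, obtained from a scalar inequality by
expanding in the eigenbases of both states. It contains Klein's inequality, hence convexity of
the relative entropy, and convexity together with continuity of the logarithm gives the time
derivative (`hasDerivAt_relEnt`). The logarithmic Sobolev inequality applies to positive definite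
matrices only. A state `ρ` is therefore replaced by `(1 - ε) ρ + ε σ`, which stays positive definite
because `σ` is stationary and the evolution preserves positivity (`evolve_posSemidef`).
-/

namespace QMix

open Matrix

variable {d : ℕ}

/-! ### The scalar inequality behind Pinsker's inequality -/

theorem three_mul_sq_le_mul_klFun {u : ℝ} (hu : 0 < u) :
    3 * (u - 1) ^ 2 ≤ (2 * u + 4) * (u * Real.log u - u + 1) := by
  -- the derivative of the difference is `4 ((v + 1) log v - 2 (v - 1))`, which is increasing and
  -- vanishes at `1`
  have hlog : ∀ v : ℝ, 0 < v → HasDerivAt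
      (fun u : ℝ => (2 * u + 4) * (u * Real.log u - u + 1) - 3 * (u - 1) ^ 2)
      (4 * ((v + 1) * Real.log v - 2 * (v - 1))) v := by
    intro v hv
    have h := ((((hasDerivAt_id v).const_mul 2).add_const 4).mul
      ((((hasDerivAt_id v).mul (Real.hasDerivAt_log hv.ne')).sub (hasDerivAt_id v)).add_const
        1)).sub ((((hasDerivAt_id v).sub_const 1).pow 2).const_mul 3)
    refine h.congr_deriv ?_
    simp only [Pi.mul_apply, Pi.sub_apply, id]
    field_simp
    ring
  have hlog' : ∀ v : ℝ, 0 < v → HasDerivAt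
      (fun v : ℝ => (v + 1) * Real.log v - 2 * (v - 1)) (Real.log v + v⁻¹ - 1) v := by
    intro v hv
    have h := (((hasDerivAt_id v).add_const 1).mul (Real.hasDerivAt_log hv.ne')).sub
      (((hasDerivAt_id v).sub_const 1).const_mul 2)
    refine h.congr_deriv ?_
    simp only [id]
    field_simp
    ring
  have hmono : MonotoneOn (fun v : ℝ => (v + 1) * Real.log v - 2 * (v - 1)) (Set.Ioi 0) := by
    refine monotoneOn_of_deriv_nonneg (convex_Ioi 0)
      (fun v hv => (hlog' v hv).continuousAt.continuousWithinAt)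
      (fun v hv => ?_) (fun v hv => ?_)
    · rw [interior_Ioi] at hv
      exact (hlog' v hv).differentiableAt.differentiableWithinAt
    · rw [interior_Ioi] at hv
      rw [(hlog' v hv).deriv]
      linarith [Real.one_sub_inv_le_log_of_pos hv]
  suffices h : 0 ≤ (2 * u + 4) * (u * Real.log u - u + 1) - 3 * (u - 1) ^ 2 by linarith
  rcases le_total u 1 with h1 | h1
  · have hanti : AntitoneOn
        (fun u : ℝ => (2 * u + 4) * (u * Real.log u - u + 1) - 3 * (u - 1) ^ 2)
        (Set.Ioc 0 1) := by
      refine antitoneOn_of_deriv_nonpos (convex_Ioc 0 1)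
        (fun v hv => (hlog v hv.1).continuousAt.continuousWithinAt)
        (fun v hv => ?_) (fun v hv => ?_)
      · rw [interior_Ioc] at hv
        exact (hlog v hv.1).differentiableAt.differentiableWithinAt
      · rw [interior_Ioc] at hv
        rw [(hlog v hv.1).deriv]
        have := hmono hv.1 (Set.mem_Ioi.2 one_pos) hv.2.le
        norm_num at this
        linarith
    have := hanti ⟨hu, h1⟩ ⟨one_pos, le_rfl⟩ h1
    norm_num at this
    linarith
  · have hmono' : MonotoneOn
        (fun u : ℝ => (2 * u + 4) * (u * Real.log u - u + 1) - 3 * (u - 1) ^ 2)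
        (Set.Ici 1) := by
      refine monotoneOn_of_deriv_nonneg (convex_Ici 1)
        (fun v hv => (hlog v (one_pos.trans_le hv)).continuousAt.continuousWithinAt)
        (fun v hv => ?_) (fun v hv => ?_)
      · rw [interior_Ici] at hv
        exact (hlog v (one_pos.trans hv)).differentiableAt.differentiableWithinAt
      · rw [interior_Ici] at hv
        rw [(hlog v (one_pos.trans hv)).deriv]
        have := hmono (Set.mem_Ioi.2 one_pos) (Set.mem_Ioi.2 (one_pos.trans hv)) (le_of_lt hv)
        norm_num at this
        linarith
    have := hmono' Set.self_mem_Ici h1 h1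
    norm_num at this
    linarith

/-- The homogeneous form of `three_mul_sq_le_mul_klFun`. The weight `(2 x + 4 y) / 3` is what gives
Pinsker's inequality its sharp constant: it sums to `2` over two probability vectors. -/
theorem sq_sub_le_mul_entropy {x y : ℝ} (hx : 0 < x) (hy : 0 < y) :
    (x - y) ^ 2 ≤ (2 * x + 4 * y) / 3 * (x * (Real.log x - Real.log y) - x + y) := by
  have h := three_mul_sq_le_mul_klFun (div_pos hx hy)
  rw [Real.log_div hx.ne' hy.ne'] at h
  have h2 := mul_le_mul_of_nonneg_left h (by positivity : 0 ≤ y ^ 2 / 3)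
  have e1 : y ^ 2 / 3 * (3 * (x / y - 1) ^ 2) = (x - y) ^ 2 := by field_simp
  have e2 : y ^ 2 / 3 * ((2 * (x / y) + 4) *
      (x / y * (Real.log x - Real.log y) - x / y + 1)) =
      (2 * x + 4 * y) / 3 * (x * (Real.log x - Real.log y) - x + y) := by
    field_simp
  rwa [e1, e2] at h2

/-! ### Spectral calculus for Hermitian matrices and the trace norm -/

theorem cfc_eq_conj {A : Mat d} (hA : A.IsHermitian) (f : ℝ → ℝ) :
    cfc f A = (hA.eigenvectorUnitary : Mat d) * diagonal (fun i => (f (hA.eigenvalues i) : ℂ)) *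
      (hA.eigenvectorUnitary : Mat d)ᴴ := by
  rw [hA.cfc_eq, IsHermitian.cfc, Unitary.conjStarAlgAut_apply]
  rfl

theorem eq_conj {A : Mat d} (hA : A.IsHermitian) :
    A = (hA.eigenvectorUnitary : Mat d) * diagonal (fun i => (hA.eigenvalues i : ℂ)) *
      (hA.eigenvectorUnitary : Mat d)ᴴ := by
  conv_lhs => rw [← cfc_id' ℝ A hA.isSelfAdjoint, cfc_eq_conj hA]

/-- The spectrum is finite, so the functional calculus applies to every function. -/
theorem continuousOn_spectrum (A : Mat d) (f : ℝ → ℝ) : ContinuousOn f (spectrum ℝ A) :=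
  (Matrix.finite_real_spectrum (A := A)).continuousOn f

theorem cfc_isHermitian (f : ℝ → ℝ) (A : Mat d) : (cfc f A).IsHermitian :=
  cfc_predicate f A

theorem trace_cfc {A : Mat d} (hA : A.IsHermitian) (f : ℝ → ℝ) :
    (cfc f A).trace = ∑ i, (f (hA.eigenvalues i) : ℂ) := by
  rw [cfc_eq_conj hA, trace_mul_cycle, ← star_eq_conjTranspose, Unitary.coe_star_mul_self,
    one_mul, trace_diagonal]

/-- The trace norm of a Hermitian matrix is attained at a self-adjoint unitary. -/
theorem exists_trNorm_eq {A : Mat d} (hA : A.IsHermitian) :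
    ∃ S : Mat d, Sᴴ = S ∧ S * S = 1 ∧ trNorm A = (S * A).trace.re := by
  refine ⟨cfc (fun x : ℝ => if x < 0 then -1 else 1) A, cfc_isHermitian _ _, ?_, ?_⟩
  · rw [← cfc_mul _ _ A (continuousOn_spectrum A _) (continuousOn_spectrum A _),
      ← cfc_const_one ℝ A hA.isSelfAdjoint]
    congr 1
    ext x
    split_ifs <;> norm_num
  · rw [trNorm, msqrt, hA.eq]
    have h1 : A * A = cfc (fun x : ℝ => x * x) A := by
      rw [cfc_mul _ _ A (continuousOn_spectrum A _) (continuousOn_spectrum A _),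
        cfc_id' ℝ A hA.isSelfAdjoint]
    have h2 : cfc (fun x : ℝ => if x < 0 then (-1 : ℝ) else 1) A * A =
        cfc (fun x : ℝ => (if x < 0 then (-1 : ℝ) else 1) * x) A := by
      rw [cfc_mul _ _ A (continuousOn_spectrum A _) (continuousOn_spectrum A _),
        cfc_id' ℝ A hA.isSelfAdjoint]
    rw [h1, h2, ← cfc_comp' Real.sqrt (fun x : ℝ => x * x) A
      (Real.continuous_sqrt.continuousOn) (continuousOn_spectrum A _) hA.isSelfAdjoint]
    congr 3
    ext x
    rw [Real.sqrt_mul_self_eq_abs]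
    split_ifs with hx
    · rw [abs_of_neg hx]; ring
    · rw [abs_of_nonneg (not_lt.1 hx)]; ring

theorem sum_normSq_row {M : Mat d} (hM : M * Mᴴ = 1) (i : Fin d) :
    ∑ j, Complex.normSq (M i j) = 1 := by
  have h := congrFun (congrFun hM i) i
  rw [mul_apply, one_apply_eq] at h
  simp only [conjTranspose_apply, Complex.star_def, Complex.mul_conj] at h
  exact_mod_cast h

theorem sum_normSq_col {M : Mat d} (hM : Mᴴ * M = 1) (j : Fin d) :
    ∑ i, Complex.normSq (M i j) = 1 := by
  have h := sum_normSq_row (M := Mᴴ) (by simpa using hM) j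
  simpa [Complex.normSq_conj] using h

/-- The trace of a product of two Hermitian matrices as a double sum over their eigenbases. -/
theorem trace_conj_mul_conj (U V : Mat d) (a b : Fin d → ℝ) :
    ((U * diagonal (fun i => (a i : ℂ)) * Uᴴ) *
      (V * diagonal (fun j => (b j : ℂ)) * Vᴴ)).trace.re =
      ∑ i, ∑ j, a i * b j * Complex.normSq ((Uᴴ * V) i j) := by
  have h1 : ((U * diagonal (fun i => (a i : ℂ)) * Uᴴ) *
      (V * diagonal (fun j => (b j : ℂ)) * Vᴴ)).trace =
      (diagonal (fun i => (a i : ℂ)) * ((Uᴴ * V) * (diagonal (fun j => (b j : ℂ)) *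
        (Uᴴ * V)ᴴ))).trace := by
    rw [conjTranspose_mul, conjTranspose_conjTranspose]
    simp only [Matrix.mul_assoc]
    rw [Matrix.trace_mul_comm]
    simp only [Matrix.mul_assoc]
  rw [h1, Matrix.trace, Complex.re_sum]
  refine Finset.sum_congr rfl fun i _ => ?_
  rw [diag_apply, diagonal_mul, mul_apply, Finset.mul_sum, Complex.re_sum]
  refine Finset.sum_congr rfl fun j _ => ?_
  rw [diagonal_mul, conjTranspose_apply, Complex.star_def,
    mul_left_comm ((Uᴴ * V) i j), Complex.mul_conj]
  norm_cast
  ring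

theorem trace_mul_conj (S U : Mat d) (D : Mat d) :
    (S * (U * D * Uᴴ)).trace = (D * (Uᴴ * S * U)).trace := by
  rw [← Matrix.mul_assoc, ← Matrix.mul_assoc, trace_mul_comm, trace_mul_comm D]
  simp only [Matrix.mul_assoc]

theorem trace_eq_sum_ofReal_eigenvalues {A : Mat d} (hA : A.IsHermitian) :
    A.trace = ∑ i, (hA.eigenvalues i : ℂ) := by
  conv_lhs => rw [← cfc_id' ℝ A hA.isSelfAdjoint, trace_cfc hA]

theorem sum_eigenvalues_eq_one {A : Mat d} (hA : A.IsHermitian) (h1 : A.trace = 1) :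
    ∑ i, hA.eigenvalues i = 1 := by
  rw [trace_eq_sum_ofReal_eigenvalues hA] at h1
  exact_mod_cast h1

/-! ### Relative entropy and Pinsker's inequality -/

theorem trace_mul_mlog_self {ρ : Mat d} (hρ : ρ.IsHermitian) :
    (ρ * mlog ρ).trace.re = ∑ i, hρ.eigenvalues i * Real.log (hρ.eigenvalues i) := by
  have : ρ * mlog ρ = cfc (fun x : ℝ => x * Real.log x) ρ := by
    rw [cfc_mul _ _ ρ (continuousOn_spectrum ρ _) (continuousOn_spectrum ρ _),
      cfc_id' ℝ ρ hρ.isSelfAdjoint, mlog]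
  rw [this, trace_cfc hρ, Complex.re_sum]
  simp

theorem trace_mul_mlog {ρ σ : Mat d} (hρ : ρ.IsHermitian) (hσ : σ.IsHermitian) :
    (ρ * mlog σ).trace.re = ∑ i, ∑ j, hρ.eigenvalues i * Real.log (hσ.eigenvalues j) *
      Complex.normSq (((hρ.eigenvectorUnitary : Mat d)ᴴ * (hσ.eigenvectorUnitary : Mat d)) i j) := by
  rw [mlog, cfc_eq_conj hσ]
  conv_lhs => rw [eq_conj hρ]
  exact trace_conj_mul_conj _ _ hρ.eigenvalues (fun j => Real.log (hσ.eigenvalues j))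

theorem minEig_le {A : Mat d} (hA : A.IsHermitian) (i : Fin d) : minEig hA ≤ hA.eigenvalues i :=
  ciInf_le (Set.finite_range _).bddBelow i

theorem minEig_pos [Nonempty (Fin d)] {A : Mat d} (hA : A.PosDef) :
    0 < minEig hA.isHermitian := by
  obtain ⟨i, hi⟩ := exists_eq_ciInf_of_finite (f := hA.isHermitian.eigenvalues)
  rw [minEig, ← hi]
  exact hA.eigenvalues_pos i

theorem nonempty_of_trace_eq_one {A : Mat d} (hA : A.trace = 1) : Nonempty (Fin d) := by
  by_contra h
  rw [not_nonempty_iff] at h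
  simp [Matrix.trace] at hA

/-- Quantum Pinsker inequality, with the trace norm replaced by its value at a self-adjoint
unitary `S`. In the eigenbases of `ρ` and `σ`, with overlaps `Wᵢⱼ` and eigenvalues `aᵢ`, `bⱼ`, the
relative entropy is `∑ |Wᵢⱼ|² (aᵢ log (aᵢ / bⱼ) - aᵢ + bⱼ)` and `tr (S (ρ - σ))` is
`∑ Mⱼᵢ Wᵢⱼ (aᵢ - bⱼ)` with `M` unitary. Cauchy–Schwarz with the weights `(2 aᵢ + 4 bⱼ) / 3`
reduces the claim to the scalar inequality `sq_sub_le_mul_entropy`. -/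
theorem sq_trace_mul_sub_le {ρ σ S : Mat d} (hρ : ρ.PosDef) (hσ : σ.PosDef)
    (hρ1 : ρ.trace = 1) (hσ1 : σ.trace = 1) (hS : Sᴴ = S) (hSS : S * S = 1) :
    (S * (ρ - σ)).trace.re ^ 2 ≤ 2 * (ρ * (mlog ρ - mlog σ)).trace.re := by
  set U : Mat d := (hρ.isHermitian.eigenvectorUnitary : Mat d) with hU
  set V : Mat d := (hσ.isHermitian.eigenvectorUnitary : Mat d) with hV
  set a := hρ.isHermitian.eigenvalues with ha
  set b := hσ.isHermitian.eigenvalues with hb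
  have ha0 : ∀ i, 0 < a i := hρ.eigenvalues_pos
  have hb0 : ∀ i, 0 < b i := hσ.eigenvalues_pos
  have hU1 : Uᴴ * U = 1 := Unitary.coe_star_mul_self _
  have hU2 : U * Uᴴ = 1 := Unitary.coe_mul_star_self _
  have hV1 : Vᴴ * V = 1 := Unitary.coe_star_mul_self _
  have hV2 : V * Vᴴ = 1 := Unitary.coe_mul_star_self _
  have hρe : ρ = U * diagonal (fun i => (a i : ℂ)) * Uᴴ := eq_conj hρ.isHermitian
  have hσe : σ = V * diagonal (fun i => (b i : ℂ)) * Vᴴ := eq_conj hσ.isHermitian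
  have hasum : ∑ i, a i = 1 := sum_eigenvalues_eq_one hρ.isHermitian hρ1
  have hbsum : ∑ i, b i = 1 := sum_eigenvalues_eq_one hσ.isHermitian hσ1
  set W : Mat d := Uᴴ * V with hW
  set M : Mat d := Vᴴ * S * U with hM
  have hW1 : W * Wᴴ = 1 := by
    rw [hW, conjTranspose_mul, conjTranspose_conjTranspose, Matrix.mul_assoc,
      ← Matrix.mul_assoc V, hV2, Matrix.one_mul, hU1]
  have hW2 : Wᴴ * W = 1 := mul_eq_one_comm.1 hW1
  have hMt : Mᴴ = Uᴴ * S * V := by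
    rw [hM, conjTranspose_mul, conjTranspose_mul, conjTranspose_conjTranspose, hS,
      Matrix.mul_assoc]
  have hM1 : M * Mᴴ = 1 := by
    calc M * Mᴴ = Vᴴ * S * (U * Uᴴ) * S * V := by rw [hMt, hM]; simp only [Matrix.mul_assoc]
      _ = Vᴴ * (S * S) * V := by rw [hU2]; simp only [Matrix.mul_assoc, Matrix.one_mul]
      _ = 1 := by rw [hSS, Matrix.mul_one, hV1]
  have hM2 : Mᴴ * M = 1 := mul_eq_one_comm.1 hM1
  have hent : (ρ * (mlog ρ - mlog σ)).trace.re =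
      ∑ i, ∑ j, Complex.normSq (W i j) *
        (a i * (Real.log (a i) - Real.log (b j)) - a i + b j) := by
    have h1 := trace_mul_mlog_self hρ.isHermitian
    have h2 := trace_mul_mlog hρ.isHermitian hσ.isHermitian
    have h3 : ∑ i, ∑ j, Complex.normSq (W i j) * (a i * Real.log (a i)) =
        ∑ i, a i * Real.log (a i) := by
      simp only [← Finset.sum_mul, sum_normSq_row hW1, one_mul]
    have h4 : ∑ i, ∑ j, Complex.normSq (W i j) * a i = 1 := by
      simp only [← Finset.sum_mul, sum_normSq_row hW1, one_mul, hasum]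
    have h5 : ∑ i, ∑ j, Complex.normSq (W i j) * b j = 1 := by
      rw [Finset.sum_comm]
      simp only [← Finset.sum_mul, sum_normSq_col hW2, one_mul, hbsum]
    have h6 : ∑ i, ∑ j, Complex.normSq (W i j) *
        (a i * (Real.log (a i) - Real.log (b j)) - a i + b j) =
        ∑ i, ∑ j, Complex.normSq (W i j) * (a i * Real.log (a i)) -
        ∑ i, ∑ j, a i * Real.log (b j) * Complex.normSq (W i j) -
        ∑ i, ∑ j, Complex.normSq (W i j) * a i + ∑ i, ∑ j, Complex.normSq (W i j) * b j := by
      simp only [← Finset.sum_sub_distrib, ← Finset.sum_add_distrib]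
      refine Finset.sum_congr rfl fun i _ => Finset.sum_congr rfl fun j _ => ?_
      ring
    rw [Matrix.mul_sub, trace_sub, Complex.sub_re, h1, h2, h6, h3, h4, h5]
    ring
  have hnorm : (S * (ρ - σ)).trace = ∑ i, ∑ j, M j i * W i j * ((a i - b j : ℝ) : ℂ) := by
    have h1 : (S * ρ).trace = ∑ i, ∑ j, M j i * W i j * (a i : ℂ) := by
      have : (S * ρ).trace = (diagonal (fun i => (a i : ℂ)) * (W * M)).trace := by
        have e : W * M = Uᴴ * S * U := by
          calc W * M = Uᴴ * (V * Vᴴ) * S * U := by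
                rw [hW, hM]; simp only [Matrix.mul_assoc]
            _ = _ := by rw [hV2, Matrix.mul_one]
        rw [e]
        conv_lhs => rw [hρe]
        exact trace_mul_conj _ _ _
      rw [this, Matrix.trace]
      refine Finset.sum_congr rfl fun i _ => ?_
      rw [diag_apply, diagonal_mul, mul_apply, Finset.mul_sum]
      exact Finset.sum_congr rfl fun j _ => by ring
    have h2 : (S * σ).trace = ∑ i, ∑ j, M j i * W i j * (b j : ℂ) := by
      have : (S * σ).trace = (diagonal (fun i => (b i : ℂ)) * (M * W)).trace := by
        have e : M * W = Vᴴ * S * V := by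
          calc M * W = Vᴴ * S * (U * Uᴴ) * V := by
                rw [hW, hM]; simp only [Matrix.mul_assoc]
            _ = _ := by rw [hU2, Matrix.mul_one]
        rw [e]
        conv_lhs => rw [hσe]
        exact trace_mul_conj _ _ _
      rw [this, Matrix.trace, Finset.sum_comm]
      refine Finset.sum_congr rfl fun i _ => ?_
      rw [diag_apply, diagonal_mul, mul_apply, Finset.mul_sum]
      exact Finset.sum_congr rfl fun j _ => by ring
    rw [Matrix.mul_sub, trace_sub, h1, h2, ← Finset.sum_sub_distrib]
    refine Finset.sum_congr rfl fun i _ => ?_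
    rw [← Finset.sum_sub_distrib]
    refine Finset.sum_congr rfl fun j _ => ?_
    push_cast
    ring
  have hw : ∀ i j, 0 < (2 * a i + 4 * b j) / 3 := fun i j => by
    have := ha0 i; have := hb0 j; positivity
  have hwsum : ∑ p : Fin d × Fin d,
      Complex.normSq (M p.2 p.1) * ((2 * a p.1 + 4 * b p.2) / 3) = 2 := by
    rw [Fintype.sum_prod_type]
    have h4 : ∑ i, ∑ j, Complex.normSq (M j i) * a i = 1 := by
      simp only [← Finset.sum_mul, sum_normSq_col hM2, one_mul, hasum]
    have h5 : ∑ i, ∑ j, Complex.normSq (M j i) * b j = 1 := by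
      rw [Finset.sum_comm]
      simp only [← Finset.sum_mul, sum_normSq_row hM1, one_mul, hbsum]
    calc ∑ i, ∑ j, Complex.normSq (M j i) * ((2 * a i + 4 * b j) / 3)
        = 2 / 3 * ∑ i, ∑ j, Complex.normSq (M j i) * a i +
          4 / 3 * ∑ i, ∑ j, Complex.normSq (M j i) * b j := by
          simp only [Finset.mul_sum, ← Finset.sum_add_distrib]
          refine Finset.sum_congr rfl fun i _ => Finset.sum_congr rfl fun j _ => ?_
          ring
      _ = 2 := by rw [h4, h5]; norm_num
  have hle : |(S * (ρ - σ)).trace.re| ≤ ∑ p : Fin d × Fin d, ‖M p.2 p.1‖ * ‖W p.1 p.2‖ *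
      |a p.1 - b p.2| := by
    rw [hnorm, ← Fintype.sum_prod_type']
    refine (Complex.abs_re_le_norm _).trans ((norm_sum_le _ _).trans (le_of_eq ?_))
    refine Finset.sum_congr rfl fun p _ => ?_
    rw [norm_mul, norm_mul, Complex.norm_real, Real.norm_eq_abs]
  have hCS := Finset.sum_sq_le_sum_mul_sum_of_sq_le_mul (Finset.univ : Finset (Fin d × Fin d))
    (r := fun p => ‖M p.2 p.1‖ * ‖W p.1 p.2‖ * |a p.1 - b p.2|)
    (f := fun p => Complex.normSq (M p.2 p.1) * ((2 * a p.1 + 4 * b p.2) / 3))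
    (g := fun p => Complex.normSq (W p.1 p.2) *
      ((a p.1 - b p.2) ^ 2 / ((2 * a p.1 + 4 * b p.2) / 3)))
    (fun p _ => mul_nonneg (Complex.normSq_nonneg _) (hw _ _).le)
    (fun p _ => mul_nonneg (Complex.normSq_nonneg _) (div_nonneg (sq_nonneg _) (hw _ _).le))
    (fun p _ => by
      rw [mul_pow, mul_pow, sq_abs, ← Complex.normSq_eq_norm_sq, ← Complex.normSq_eq_norm_sq]
      rw [mul_mul_mul_comm, mul_div_cancel₀ _ (hw p.1 p.2).ne'])
  rw [hwsum] at hCS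
  calc (S * (ρ - σ)).trace.re ^ 2 = |(S * (ρ - σ)).trace.re| ^ 2 := (sq_abs _).symm
    _ ≤ _ := pow_le_pow_left₀ (abs_nonneg _) hle 2
    _ ≤ _ := hCS
    _ ≤ _ := by
      rw [hent, ← Fintype.sum_prod_type']
      refine mul_le_mul_of_nonneg_left (Finset.sum_le_sum fun p _ => ?_) zero_le_two
      refine mul_le_mul_of_nonneg_left ?_ (Complex.normSq_nonneg _)
      rw [div_le_iff₀' (hw _ _)]
      exact sq_sub_le_mul_entropy (ha0 _) (hb0 _)

/-- `tr (ρ log ρ) ≤ 0`, as the eigenvalues of `ρ` are at most `1`, and `log σ ≥ log σ_min`. -/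
theorem relEnt_le {ρ σ : Mat d} (hρ : ρ.PosDef) (hσ : σ.PosDef)
    (hρ1 : ρ.trace = 1) :
    (ρ * (mlog ρ - mlog σ)).trace.re ≤ Real.log (1 / minEig hσ.isHermitian) := by
  have : Nonempty (Fin d) := nonempty_of_trace_eq_one hρ1
  have hmin := minEig_pos hσ
  have hsum := sum_eigenvalues_eq_one hρ.isHermitian hρ1
  have hW : ∀ i, ∑ j, Complex.normSq (((hρ.isHermitian.eigenvectorUnitary : Mat d)ᴴ *
      (hσ.isHermitian.eigenvectorUnitary : Mat d)) i j) = 1 := fun i =>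
    sum_normSq_row (Unitary.coe_mul_star_self
      (star hρ.isHermitian.eigenvectorUnitary * hσ.isHermitian.eigenvectorUnitary)) i
  have h1 : (ρ * mlog ρ).trace.re ≤ 0 := by
    rw [trace_mul_mlog_self hρ.isHermitian]
    refine Finset.sum_nonpos fun i _ => mul_nonpos_of_nonneg_of_nonpos
      (hρ.eigenvalues_pos i).le (Real.log_nonpos (hρ.eigenvalues_pos i).le ?_)
    rw [← hsum]
    exact Finset.single_le_sum (fun j _ => (hρ.eigenvalues_pos j).le) (Finset.mem_univ i)
  have h2 : Real.log (minEig hσ.isHermitian) ≤ (ρ * mlog σ).trace.re := by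
    rw [trace_mul_mlog hρ.isHermitian hσ.isHermitian]
    calc Real.log (minEig hσ.isHermitian)
        = ∑ i, ∑ j, hρ.isHermitian.eigenvalues i * Real.log (minEig hσ.isHermitian) *
          Complex.normSq (((hρ.isHermitian.eigenvectorUnitary : Mat d)ᴴ *
            (hσ.isHermitian.eigenvectorUnitary : Mat d)) i j) := by
          simp only [← Finset.mul_sum, hW, mul_one, ← Finset.sum_mul, hsum, one_mul]
      _ ≤ _ := by
          refine Finset.sum_le_sum fun i _ => Finset.sum_le_sum fun j _ => ?_
          refine mul_le_mul_of_nonneg_right (mul_le_mul_of_nonneg_left ?_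
            (hρ.eigenvalues_pos i).le) (Complex.normSq_nonneg _)
          exact Real.log_le_log hmin (minEig_le _ j)
  rw [one_div, Real.log_inv, Matrix.mul_sub, trace_sub, Complex.sub_re]
  linarith

/-! ### The weighting map and the χ² divergence -/

theorem msqrt_mul_self {σ : Mat d} (hσ : σ.PosDef) : msqrt σ * msqrt σ = σ := by
  rw [msqrt, ← cfc_mul _ _ σ (continuousOn_spectrum σ _) (continuousOn_spectrum σ _)]
  conv_rhs => rw [← cfc_id' ℝ σ hσ.isHermitian.isSelfAdjoint]
  refine cfc_congr fun x hx => ?_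
  rw [hσ.isHermitian.spectrum_real_eq_range_eigenvalues] at hx
  obtain ⟨i, rfl⟩ := hx
  exact Real.mul_self_sqrt (hσ.eigenvalues_pos i).le

theorem isUnit_det_msqrt {σ : Mat d} (hσ : σ.PosDef) : IsUnit (msqrt σ).det := by
  have h : IsUnit (msqrt σ * msqrt σ).det := by
    rw [msqrt_mul_self hσ]
    exact (Matrix.isUnit_iff_isUnit_det _).1 hσ.isUnit
  rw [det_mul] at h
  exact isUnit_of_mul_isUnit_left h

theorem gam_apply (σ f : Mat d) : gam σ f = msqrt σ * f * msqrt σ := rfl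

theorem gamInv_apply (σ f : Mat d) : gamInv σ f = (msqrt σ)⁻¹ * f * (msqrt σ)⁻¹ := rfl

theorem gam_gamInv {σ : Mat d} (hσ : σ.PosDef) (f : Mat d) : gam σ (gamInv σ f) = f := by
  have h := isUnit_det_msqrt hσ
  rw [gam_apply, gamInv_apply]
  simp only [Matrix.mul_assoc]
  rw [nonsing_inv_mul _ h, Matrix.mul_one, mul_nonsing_inv_cancel_left _ _ h]

theorem gamInv_self {σ : Mat d} (hσ : σ.PosDef) : gamInv σ σ = 1 := by
  have h := isUnit_det_msqrt hσ
  rw [gamInv_apply]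
  calc (msqrt σ)⁻¹ * σ * (msqrt σ)⁻¹
      = (msqrt σ)⁻¹ * (msqrt σ * msqrt σ) * (msqrt σ)⁻¹ := by rw [msqrt_mul_self hσ]
    _ = 1 := by rw [nonsing_inv_mul_cancel_left _ _ h, mul_nonsing_inv _ h]

theorem msqrt_isHermitian (σ : Mat d) : (msqrt σ).IsHermitian := cfc_isHermitian _ _

theorem gamInv_isHermitian {σ f : Mat d} (hf : f.IsHermitian) : (gamInv σ f).IsHermitian := by
  have h := isHermitian_mul_mul_conjTranspose (msqrt σ)⁻¹ hf
  rwa [(msqrt_isHermitian σ).inv.eq] at h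

theorem gamInv_posDef {σ f : Mat d} (hσ : σ.PosDef) (hf : f.PosDef) : (gamInv σ f).PosDef := by
  have hu : IsUnit (msqrt σ)⁻¹ := by
    rw [Matrix.isUnit_nonsing_inv_iff]
    exact (Matrix.isUnit_iff_isUnit_det _).2 (isUnit_det_msqrt hσ)
  have h := (Matrix.IsUnit.posDef_star_right_conjugate_iff hu (x := f)).2 hf
  rwa [star_eq_conjTranspose, (msqrt_isHermitian σ).inv.eq] at h

theorem inv_msqrt_eq_conj {σ : Mat d} (hσ : σ.PosDef) :
    (msqrt σ)⁻¹ = (hσ.isHermitian.eigenvectorUnitary : Mat d) *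
      diagonal (fun i => (((√(hσ.isHermitian.eigenvalues i))⁻¹ : ℝ) : ℂ)) *
      (hσ.isHermitian.eigenvectorUnitary : Mat d)ᴴ := by
  refine inv_eq_right_inv ?_
  rw [← cfc_eq_conj hσ.isHermitian (fun x => (√x)⁻¹), msqrt,
    ← cfc_mul _ _ σ (continuousOn_spectrum σ _) (continuousOn_spectrum σ _),
    ← cfc_const_one ℝ σ hσ.isHermitian.isSelfAdjoint]
  refine cfc_congr fun x hx => ?_
  rw [hσ.isHermitian.spectrum_real_eq_range_eigenvalues] at hx
  obtain ⟨i, rfl⟩ := hx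
  exact mul_inv_cancel₀ (Real.sqrt_pos.2 (hσ.eigenvalues_pos i)).ne'

/-- `tr (A σ^(-1/2) A σ^(-1/2)) = ∑ |Nᵢⱼ|² / √(bᵢ bⱼ)`, with `N` the matrix of `A` in an
eigenbasis of `σ` and `bᵢ` the eigenvalues. -/
theorem trace_mul_gamInv {σ A : Mat d} (hσ : σ.PosDef) (hA : A.IsHermitian) :
    (A * gamInv σ A).trace.re = ∑ i, ∑ j,
      Complex.normSq (((hσ.isHermitian.eigenvectorUnitary : Mat d)ᴴ * A *
        (hσ.isHermitian.eigenvectorUnitary : Mat d)) i j) *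
      ((√(hσ.isHermitian.eigenvalues i))⁻¹ * (√(hσ.isHermitian.eigenvalues j))⁻¹) := by
  set V : Mat d := (hσ.isHermitian.eigenvectorUnitary : Mat d) with hV
  set b := hσ.isHermitian.eigenvalues with hb
  set N : Mat d := Vᴴ * A * V with hN
  set D : Mat d := diagonal (fun i => (((√(b i))⁻¹ : ℝ) : ℂ)) with hD
  have hNh : Nᴴ = N := by
    rw [hN, conjTranspose_mul, conjTranspose_mul, conjTranspose_conjTranspose, hA.eq,
      Matrix.mul_assoc]
  have h1 : (A * gamInv σ A).trace = ((D * N) * (D * Nᴴ)).trace := by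
    rw [gamInv_apply, inv_msqrt_eq_conj hσ, ← hV, ← hb, ← hD, hNh, hN, ← Matrix.mul_assoc,
      trace_mul_comm, ← Matrix.mul_assoc (V * D * Vᴴ), Matrix.mul_assoc V, Matrix.mul_assoc V,
      Matrix.mul_assoc V, trace_mul_comm V]
    simp only [Matrix.mul_assoc]
  rw [h1, Matrix.trace, Complex.re_sum]
  refine Finset.sum_congr rfl fun i _ => ?_
  rw [diag_apply, mul_apply, Complex.re_sum]
  refine Finset.sum_congr rfl fun j _ => ?_
  rw [hD, diagonal_mul, diagonal_mul, conjTranspose_apply, Complex.star_def, mul_mul_mul_comm,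
    Complex.mul_conj]
  norm_cast
  ring

/-- The `χ²` bound on the trace norm. In an eigenbasis of `σ` this is the Cauchy–Schwarz inequality
for `tr (S A) = ∑ Nᵢⱼ Mⱼᵢ` with weights `√(bᵢ bⱼ)`: since `M` is unitary and
`√(bᵢ bⱼ) ≤ (bᵢ + bⱼ) / 2`, one has `∑ |Mⱼᵢ|² √(bᵢ bⱼ) ≤ ∑ bᵢ = 1`. -/
theorem sq_trNorm_le_trace_mul_gamInv {σ A : Mat d} (hσ : σ.PosDef) (hσ1 : σ.trace = 1)
    (hA : A.IsHermitian) : trNorm A ^ 2 ≤ (A * gamInv σ A).trace.re := by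
  obtain ⟨S, hS, hSS, hS1⟩ := exists_trNorm_eq hA
  rw [trace_mul_gamInv hσ hA]
  set V : Mat d := (hσ.isHermitian.eigenvectorUnitary : Mat d) with hV
  set b := hσ.isHermitian.eigenvalues with hb
  have hb0 : ∀ i, 0 < √(b i) := fun i => Real.sqrt_pos.2 (hσ.eigenvalues_pos i)
  have hbs : ∀ i, √(b i) ^ 2 = b i := fun i => Real.sq_sqrt (hσ.eigenvalues_pos i).le
  have hbsum : ∑ i, b i = 1 := sum_eigenvalues_eq_one hσ.isHermitian hσ1
  have hV1 : Vᴴ * V = 1 := Unitary.coe_star_mul_self _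
  have hV2 : V * Vᴴ = 1 := Unitary.coe_mul_star_self _
  set N : Mat d := Vᴴ * A * V with hN
  set M : Mat d := Vᴴ * S * V with hM
  have hMt : Mᴴ = M := by
    rw [hM, conjTranspose_mul, conjTranspose_mul, conjTranspose_conjTranspose, hS,
      Matrix.mul_assoc]
  have hM1 : M * M = 1 := by
    calc M * M = Vᴴ * S * (V * Vᴴ) * S * V := by rw [hM]; simp only [Matrix.mul_assoc]
      _ = Vᴴ * (S * S) * V := by rw [hV2]; simp only [Matrix.mul_assoc, Matrix.one_mul]
      _ = 1 := by rw [hSS, Matrix.mul_one, hV1]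
  have hM2 : M * Mᴴ = 1 := by rw [hMt, hM1]
  have hM3 : Mᴴ * M = 1 := by rw [hMt, hM1]
  have htr : (S * A).trace = ∑ i, ∑ j, N i j * M j i := by
    have h : (S * A).trace = (N * M).trace := by
      have : N * M = Vᴴ * (A * S * V) := by
        calc N * M = Vᴴ * A * (V * Vᴴ) * S * V := by rw [hN, hM]; simp only [Matrix.mul_assoc]
          _ = _ := by rw [hV2]; simp only [Matrix.mul_assoc, Matrix.one_mul]
      rw [this, trace_mul_comm Vᴴ, Matrix.mul_assoc, hV2, Matrix.mul_one, trace_mul_comm]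
    rw [h]
    simp only [Matrix.trace, diag_apply, mul_apply]
  have hf : ∑ p : Fin d × Fin d, Complex.normSq (M p.2 p.1) * (√(b p.1) * √(b p.2)) ≤ 1 := by
    rw [Fintype.sum_prod_type]
    have h4 : ∑ i, ∑ j, Complex.normSq (M j i) * b i = 1 := by
      simp only [← Finset.sum_mul, sum_normSq_col hM3, one_mul, hbsum]
    have h5 : ∑ i, ∑ j, Complex.normSq (M j i) * b j = 1 := by
      rw [Finset.sum_comm]
      simp only [← Finset.sum_mul, sum_normSq_row hM2, one_mul, hbsum]
    calc ∑ i, ∑ j, Complex.normSq (M j i) * (√(b i) * √(b j))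
        ≤ ∑ i, ∑ j, Complex.normSq (M j i) * ((b i + b j) / 2) := by
          refine Finset.sum_le_sum fun i _ => Finset.sum_le_sum fun j _ =>
            mul_le_mul_of_nonneg_left ?_ (Complex.normSq_nonneg _)
          have := two_mul_le_add_sq (√(b i)) (√(b j))
          rw [hbs, hbs] at this
          linarith
      _ = (∑ i, ∑ j, Complex.normSq (M j i) * b i +
          ∑ i, ∑ j, Complex.normSq (M j i) * b j) / 2 := by
          simp only [Finset.sum_div, ← Finset.sum_add_distrib]
          refine Finset.sum_congr rfl fun i _ => Finset.sum_congr rfl fun j _ => ?_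
          ring
      _ = 1 := by rw [h4, h5]; norm_num
  have hle : |trNorm A| ≤ ∑ p : Fin d × Fin d, ‖N p.1 p.2‖ * ‖M p.2 p.1‖ := by
    rw [hS1, htr, ← Fintype.sum_prod_type']
    refine (Complex.abs_re_le_norm _).trans ((norm_sum_le _ _).trans (le_of_eq ?_))
    exact Finset.sum_congr rfl fun p _ => norm_mul _ _
  have hg0 : ∀ p : Fin d × Fin d,
      0 ≤ Complex.normSq (N p.1 p.2) * ((√(b p.1))⁻¹ * (√(b p.2))⁻¹) := fun p =>
    mul_nonneg (Complex.normSq_nonneg _)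
      (mul_nonneg (inv_nonneg.2 (hb0 _).le) (inv_nonneg.2 (hb0 _).le))
  have hCS := Finset.sum_sq_le_sum_mul_sum_of_sq_le_mul (Finset.univ : Finset (Fin d × Fin d))
    (r := fun p => ‖N p.1 p.2‖ * ‖M p.2 p.1‖)
    (f := fun p => Complex.normSq (M p.2 p.1) * (√(b p.1) * √(b p.2)))
    (g := fun p => Complex.normSq (N p.1 p.2) * ((√(b p.1))⁻¹ * (√(b p.2))⁻¹))
    (fun p _ => mul_nonneg (Complex.normSq_nonneg _) (mul_nonneg (hb0 _).le (hb0 _).le))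
    (fun p _ => hg0 p)
    (fun p _ => by
      rw [mul_pow, ← Complex.normSq_eq_norm_sq, ← Complex.normSq_eq_norm_sq]
      have h1 := (hb0 p.1).ne'
      have h2 := (hb0 p.2).ne'
      refine le_of_eq ?_
      field_simp)
  calc trNorm A ^ 2 = |trNorm A| ^ 2 := (sq_abs _).symm
    _ ≤ _ := pow_le_pow_left₀ (abs_nonneg _) hle 2
    _ ≤ _ := hCS
    _ ≤ _ := mul_le_of_le_one_left (Finset.sum_nonneg fun p _ => hg0 p) hf
    _ = _ := Fintype.sum_prod_type' (fun i j =>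
        Complex.normSq (N i j) * ((√(b i))⁻¹ * (√(b j))⁻¹))

theorem trace_sq_le_one {ρ : Mat d} (hρ : IsState ρ) : (ρ * ρ).trace.re ≤ 1 := by
  have hH := hρ.1.isHermitian
  have h0 : ∀ i, 0 ≤ hH.eigenvalues i := hρ.1.eigenvalues_nonneg
  have hsum := sum_eigenvalues_eq_one hH hρ.2
  have h1 : ρ * ρ = cfc (fun x : ℝ => x * x) ρ := by
    rw [cfc_mul _ _ ρ (continuousOn_spectrum ρ _) (continuousOn_spectrum ρ _),
      cfc_id' ℝ ρ hH.isSelfAdjoint]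
  rw [h1, trace_cfc hH, Complex.re_sum]
  conv_rhs => rw [← hsum]
  refine Finset.sum_le_sum fun i _ => ?_
  rw [Complex.ofReal_re]
  refine mul_le_of_le_one_left (h0 i) ?_
  rw [← hsum]
  exact Finset.single_le_sum (fun j _ => h0 j) (Finset.mem_univ i)

theorem trace_mul_gamInv_le {σ ρ : Mat d} (hσ : σ.PosDef) (hρ : IsState ρ) :
    (ρ * gamInv σ ρ).trace.re ≤ 1 / minEig hσ.isHermitian := by
  have : Nonempty (Fin d) := nonempty_of_trace_eq_one hρ.2
  have hmin := minEig_pos hσ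
  rw [trace_mul_gamInv hσ hρ.1.isHermitian]
  set V : Mat d := (hσ.isHermitian.eigenvectorUnitary : Mat d) with hV
  set N : Mat d := Vᴴ * ρ * V with hN
  have hV2 : V * Vᴴ = 1 := Unitary.coe_mul_star_self _
  have hNN : ∑ i, ∑ j, Complex.normSq (N i j) ≤ 1 := by
    have h1 : (ρ * ρ).trace = (N * Nᴴ).trace := by
      have : N * Nᴴ = Vᴴ * (ρ * ρ * V) := by
        calc N * Nᴴ = Vᴴ * ρ * (V * Vᴴ) * ρ * V := by
              rw [hN, conjTranspose_mul, conjTranspose_mul, conjTranspose_conjTranspose,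
                hρ.1.isHermitian.eq]
              simp only [Matrix.mul_assoc]
          _ = _ := by rw [hV2]; simp only [Matrix.mul_assoc, Matrix.one_mul]
      rw [this, trace_mul_comm Vᴴ, Matrix.mul_assoc, hV2, Matrix.mul_one]
    refine le_trans (le_of_eq ?_) (trace_sq_le_one hρ)
    rw [h1, Matrix.trace, Complex.re_sum]
    refine Finset.sum_congr rfl fun i _ => ?_
    rw [diag_apply, mul_apply, Complex.re_sum]
    refine Finset.sum_congr rfl fun j _ => ?_
    rw [conjTranspose_apply, Complex.star_def, Complex.mul_conj, Complex.ofReal_re]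
  have hq : ∀ i, (√(hσ.isHermitian.eigenvalues i))⁻¹ ≤ (√(minEig hσ.isHermitian))⁻¹ := fun i =>
    inv_anti₀ (Real.sqrt_pos.2 hmin) (Real.sqrt_le_sqrt (minEig_le _ i))
  calc _ ≤ ∑ i, ∑ j, Complex.normSq (N i j) * (1 / minEig hσ.isHermitian) := by
        refine Finset.sum_le_sum fun i _ => Finset.sum_le_sum fun j _ =>
          mul_le_mul_of_nonneg_left ?_ (Complex.normSq_nonneg _)
        calc _ ≤ (√(minEig hσ.isHermitian))⁻¹ * (√(minEig hσ.isHermitian))⁻¹ :=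
              mul_le_mul (hq i) (hq j) (by positivity) (by positivity)
          _ = _ := by rw [← mul_inv, Real.mul_self_sqrt hmin.le, one_div]
    _ ≤ _ := by
        simp only [← Finset.sum_mul]
        exact mul_le_of_le_one_left (by positivity) hNN

/-! ### The Schrödinger evolution is positive and preserves the trace -/

theorem isClosed_posSemidef : IsClosed {A : Mat d | A.PosSemidef} := by
  have h : {A : Mat d | A.PosSemidef} = {A | Aᴴ = A} ∩
      ⋂ x : Fin d → ℂ, {A | 0 ≤ (star x ⬝ᵥ (A *ᵥ x)).re} ∩ {A | (star x ⬝ᵥ (A *ᵥ x)).im = 0} := by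
    ext A
    simp only [posSemidef_iff_dotProduct_mulVec, Set.mem_ofPred_eq, Set.mem_inter_iff,
      Set.mem_iInter, IsHermitian, Complex.nonneg_iff, eq_comm (a := (0 : ℝ))]
  rw [h]
  refine (isClosed_eq (by fun_prop) continuous_id).inter (isClosed_iInter fun x => ?_)
  exact (isClosed_le continuous_const (by fun_prop)).inter
    (isClosed_eq (by fun_prop) continuous_const)

/-- The Lindblad generator in the Schrödinger picture is `ρ ↦ G ρ + ρ G† + ∑ Kᵢ ρ Kᵢ†` with
`G = -i H - ½ ∑ Kᵢ† Kᵢ`. -/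
theorem hsDual_eq {m : ℕ} {L : Mat d →ₗ[ℂ] Mat d} {H : Mat d} {K : Fin m → Mat d}
    (hH : H.IsHermitian) (hL : ∀ f, L f = lindblad H K f) (ρ : Mat d) :
    hsDual L ρ = (-(Complex.I • H) - (1 / 2 : ℂ) • ∑ i, (K i)ᴴ * K i) * ρ +
      ρ * (-(Complex.I • H) - (1 / 2 : ℂ) • ∑ i, (K i)ᴴ * K i)ᴴ + ∑ i, K i * ρ * (K i)ᴴ := by
  set G : Mat d := -(Complex.I • H) - (1 / 2 : ℂ) • ∑ i, (K i)ᴴ * K i with hG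
  have hGt : Gᴴ = Complex.I • H - (1 / 2 : ℂ) • ∑ i, (K i)ᴴ * K i := by
    simp [hG, conjTranspose_sub, conjTranspose_sum, hH.eq]
  have hdual : ∀ X : Mat d, (L Xᴴ)ᴴ = X * G + Gᴴ * X + ∑ i, (K i)ᴴ * X * K i := by
    intro X
    have h1 : L Xᴴ = Gᴴ * Xᴴ + Xᴴ * G + ∑ i, (K i)ᴴ * Xᴴ * K i := by
      rw [hL, lindblad, hGt, hG, Finset.sum_sub_distrib, ← Finset.smul_sum,
        Finset.sum_add_distrib, ← Finset.sum_mul, ← Finset.mul_sum]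
      simp only [Matrix.sub_mul, Matrix.mul_sub, Matrix.mul_neg, smul_mul_assoc,
        mul_smul_comm, smul_sub, smul_add]
      abel
    rw [h1]
    simp only [conjTranspose_add, conjTranspose_mul, conjTranspose_sum,
      conjTranspose_conjTranspose, Matrix.mul_assoc]
  rw [ext_iff_trace_mul_left]
  intro X
  have h := trace_conjTranspose_mul_hsDual L Xᴴ ρ
  rw [conjTranspose_conjTranspose, hdual] at h
  rw [h, Matrix.add_mul, Matrix.add_mul, Matrix.mul_add, Matrix.mul_add, Finset.sum_mul,
    Finset.mul_sum]
  simp only [trace_add, trace_sum]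
  congr 1
  · congr 1
    · rw [Matrix.mul_assoc]
    · rw [Matrix.mul_assoc, trace_mul_comm, Matrix.mul_assoc]
  · refine Finset.sum_congr rfl fun i _ => ?_
    rw [Matrix.mul_assoc, Matrix.mul_assoc, trace_mul_comm]
    simp only [Matrix.mul_assoc]

theorem trace_hsDual {L : Mat d →ₗ[ℂ] Mat d} (hL : IsLiouvillian L) (ρ : Mat d) :
    (hsDual L ρ).trace = 0 := by
  obtain ⟨m, H, K, hH, hL⟩ := hL
  have h := trace_conjTranspose_mul_hsDual L 1 ρ
  have h1 : L 1 = 0 := by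
    rw [hL, lindblad]
    simp only [Matrix.mul_one, Matrix.one_mul, sub_self, smul_zero, zero_add]
    refine Finset.sum_eq_zero fun i _ => ?_
    rw [← two_smul ℂ, smul_smul]
    norm_num
  simpa [h1] using h

section ExpSeries

variable {E : Type*} [NormedAddCommGroup E] [NormedSpace ℂ E] [FiniteDimensional ℂ E]

theorem exp_apply_eq_of_hasSum {A : E →ₗ[ℂ] E} {t : ℂ} {x y : E}
    (h : HasSum (fun n : ℕ => (t ^ n / (n.factorial : ℂ)) • (A ^ n) x) y) :
    NormedSpace.exp (t • LinearMap.toContinuousLinearMap A) x = y := by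
  have : CompleteSpace E := FiniteDimensional.complete ℂ E
  have h1 := NormedSpace.exp_series_hasSum_exp' (𝕂 := ℂ) (t • LinearMap.toContinuousLinearMap A)
  have h2 := (ContinuousLinearMap.apply ℂ E x).hasSum h1
  refine h2.unique ?_
  convert h using 2 with n
  have hn : ((LinearMap.toContinuousLinearMap A) ^ n) x = (A ^ n) x := by
    induction n with
    | zero => rfl
    | succ k ih => rw [pow_succ', pow_succ', Module.End.mul_apply, ← ih]; rfl
  rw [ContinuousLinearMap.apply_apply, smul_pow, smul_smul, ← hn, div_eq_inv_mul]
  rfl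

/-- An orbit of `exp (t A)`, given by the exponential series, solves `u' = A u`. The statement is
tested against linear functionals so that it does not depend on the norm chosen on `E`. -/
theorem hasDerivAt_of_hasSum_exp {A : E →ₗ[ℂ] E} {x : E} {u : ℝ → E}
    (hu : ∀ t : ℝ, HasSum (fun n : ℕ => ((t : ℂ) ^ n / (n.factorial : ℂ)) • (A ^ n) x) (u t))
    (l : E →ₗ[ℂ] ℂ) (t : ℝ) :
    HasDerivAt (fun s => l (u s)) (l (A (u t))) t := by
  have : CompleteSpace E := FiniteDimensional.complete ℂ E
  have h := hasDerivAt_exp_smul_const' (𝕂 := ℂ) (LinearMap.toContinuousLinearMap A) (t : ℂ)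
  have h2 := (((LinearMap.toContinuousLinearMap l).comp
    (ContinuousLinearMap.apply ℂ E x)).hasFDerivAt.comp_hasDerivAt (t : ℂ) h).comp_ofReal
  have e : ∀ s : ℝ, NormedSpace.exp ((s : ℂ) • LinearMap.toContinuousLinearMap A) x = u s :=
    fun s => exp_apply_eq_of_hasSum (hu s)
  simp only [← e]
  exact h2

/-- A map that leaves a closed convex cone invariant has an exponential that does so. -/
theorem exp_apply_mem {C : Set E} (hC : IsClosed C) (h0 : 0 ∈ C)
    (hadd : ∀ x ∈ C, ∀ y ∈ C, x + y ∈ C) (hsmul : ∀ r : ℝ, 0 ≤ r → ∀ x ∈ C, (r : ℂ) • x ∈ C)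
    {Φ : E →L[ℂ] E} (hΦ : ∀ x ∈ C, Φ x ∈ C) {x : E} (hx : x ∈ C) :
    NormedSpace.exp Φ x ∈ C := by
  have : CompleteSpace E := FiniteDimensional.complete ℂ E
  have hpow : ∀ n : ℕ, (Φ ^ n) x ∈ C := by
    intro n
    induction n with
    | zero => simpa using hx
    | succ k ih =>
      rw [pow_succ']
      exact hΦ _ ih
  have h := NormedSpace.exp_series_hasSum_exp' (𝕂 := ℂ) Φ
  have h2 := (ContinuousLinearMap.apply ℂ E x).hasSum h
  refine hC.mem_of_tendsto h2 (Filter.Eventually.of_forall fun s => ?_)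
  refine Finset.sum_induction _ (· ∈ C) (fun a b ha hb => hadd a ha b hb) h0 fun n _ => ?_
  have := hsmul ((n.factorial : ℝ))⁻¹ (by positivity) _ (hpow n)
  simpa using this

/-- Invariance of a closed convex cone `C` under `exp (t A)`, if for some `B` each map
`A + a⁻¹ B + a` with `a > 0` preserves `C`: then `exp (t (A + a⁻¹ B))`, being `exp (-t a)` times
the exponential of a map preserving `C`, preserves `C`, and it tends to `exp (t A)` as `a → ∞`. -/
theorem mem_of_hasSum_exp {C : Set E} (hC : IsClosed C) (h0 : 0 ∈ C)
    (hadd : ∀ x ∈ C, ∀ y ∈ C, x + y ∈ C) (hsmul : ∀ r : ℝ, 0 ≤ r → ∀ x ∈ C, (r : ℂ) • x ∈ C)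
    {A B : E →ₗ[ℂ] E}
    (hAB : ∀ a : ℝ, 0 < a → ∀ x ∈ C, A x + ((a⁻¹ : ℝ) : ℂ) • B x + (a : ℂ) • x ∈ C)
    {t : ℝ} (ht : 0 ≤ t) {x y : E} (hx : x ∈ C)
    (hy : HasSum (fun n : ℕ => ((t : ℂ) ^ n / (n.factorial : ℂ)) • (A ^ n) x) y) : y ∈ C := by
  have : CompleteSpace E := FiniteDimensional.complete ℂ E
  let _ := NormedAlgebra.restrictScalars ℚ ℂ (E →L[ℂ] E)
  set A' := LinearMap.toContinuousLinearMap A with hA'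
  set B' := LinearMap.toContinuousLinearMap B with hB'
  have hpos : ∀ a : ℝ, 0 < a →
      NormedSpace.exp ((t : ℂ) • (A' + ((a⁻¹ : ℝ) : ℂ) • B')) x ∈ C := by
    intro a ha
    have e : (t : ℂ) • (A' + ((a⁻¹ : ℝ) : ℂ) • B') =
        (t : ℂ) • (A' + ((a⁻¹ : ℝ) : ℂ) • B' + (a : ℂ) • 1) +
          algebraMap ℂ (E →L[ℂ] E) (-(t * a : ℝ)) := by
      rw [Algebra.algebraMap_eq_smul_one, smul_add _ _ ((a : ℂ) • (1 : E →L[ℂ] E)), smul_smul,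
        add_assoc, ← add_smul]
      push_cast
      rw [add_neg_cancel, zero_smul, add_zero]
    rw [e, NormedSpace.exp_add_of_commute (Algebra.commutes _ _).symm,
      ← NormedSpace.algebraMap_exp_comm, Algebra.algebraMap_eq_smul_one, ← Complex.exp_eq_exp_ℂ,
      ← Complex.ofReal_neg, ← Complex.ofReal_exp]
    refine exp_apply_mem hC h0 hadd hsmul (fun z hz => hsmul t ht _ (hAB a ha z hz)) ?_
    exact hsmul _ (Real.exp_pos _).le x hx
  have hlim : Filter.Tendsto
      (fun a : ℝ => NormedSpace.exp ((t : ℂ) • (A' + ((a⁻¹ : ℝ) : ℂ) • B')) x)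
      Filter.atTop (nhds y) := by
    rw [← exp_apply_eq_of_hasSum hy]
    have hexp := NormedSpace.exp_continuous (𝔸 := E →L[ℂ] E)
    have hc : Continuous fun s : ℝ =>
        NormedSpace.exp ((t : ℂ) • (A' + (s : ℂ) • B')) x := by
      fun_prop
    have h0 := (hc.tendsto 0).comp tendsto_inv_atTop_zero
    rwa [Complex.ofReal_zero, zero_smul, add_zero] at h0
  exact hC.mem_of_tendsto hlim ((Filter.eventually_gt_atTop 0).mono fun a ha => hpos a ha)

end ExpSeries

/-- Positivity of the quantum Markov semigroup: with `A` the Lindblad generator and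
`B x = G x G†`, the map `A + a⁻¹ B + a` is completely positive for every `a > 0`. -/
theorem evolve_posSemidef {L : Mat d →ₗ[ℂ] Mat d} (hL : IsLiouvillian L) {t : ℝ} (ht : 0 ≤ t)
    {ρ : Mat d} (hρ : ρ.PosSemidef) : (evolve L t ρ).PosSemidef := by
  obtain ⟨m, H, K, hH, hL⟩ := hL
  set G : Mat d := -(Complex.I • H) - (1 / 2 : ℂ) • ∑ i, (K i)ᴴ * K i with hG
  have hsmul : ∀ r : ℝ, 0 ≤ r → ∀ x : Mat d, x.PosSemidef → ((r : ℂ) • x).PosSemidef :=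
    fun r hr x hx => hx.smul (by exact_mod_cast hr)
  set B : Mat d →ₗ[ℂ] Mat d := LinearMap.mulLeftRight ℂ (G, Gᴴ) with hB
  have key : ∀ a : ℝ, 0 < a → ∀ x : Mat d, x.PosSemidef →
      (hsDual L x + ((a⁻¹ : ℝ) : ℂ) • B x + (a : ℂ) • x).PosSemidef := by
    intro a ha x hx
    have ha' : (a : ℂ) ≠ 0 := by exact_mod_cast ha.ne'
    -- `a⁻¹ (a + G) x (a + G)† = a x + (G x + x G†) + a⁻¹ G x G†`
    have e : hsDual L x + ((a⁻¹ : ℝ) : ℂ) • B x + (a : ℂ) • x =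
        ((a⁻¹ : ℝ) : ℂ) • (((a : ℂ) • 1 + G) * x * ((a : ℂ) • 1 + G)ᴴ) +
          ∑ i, K i * x * (K i)ᴴ := by
      rw [hsDual_eq hH hL x, ← hG, hB, LinearMap.mulLeftRight_apply]
      simp only [conjTranspose_add, conjTranspose_smul, conjTranspose_one, Matrix.add_mul,
        Matrix.mul_add, smul_mul_assoc, mul_smul_comm, Matrix.one_mul, Matrix.mul_one, smul_add,
        smul_smul, Complex.ofReal_inv, Complex.star_def, Complex.conj_ofReal]
      rw [← mul_assoc, inv_mul_cancel₀ ha', one_mul, one_smul, one_smul]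
      abel
    have hp : (((a⁻¹ : ℝ) : ℂ) • (((a : ℂ) • 1 + G) * x * ((a : ℂ) • 1 + G)ᴴ) +
        ∑ i, K i * x * (K i)ᴴ).PosSemidef :=
      PosSemidef.add (hsmul _ (inv_pos.2 ha).le _ (PosSemidef.mul_mul_conjTranspose_same hx _))
        (posSemidef_sum _ fun i _ => PosSemidef.mul_mul_conjTranspose_same hx _)
    rwa [← e] at hp
  refine mem_of_hasSum_exp (E := Fin d → Fin d → ℂ) (C := {A : Mat d | A.PosSemidef})
    isClosed_posSemidef PosSemidef.zero (fun x hx y hy => PosSemidef.add hx hy) hsmul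
    (A := hsDual L) (B := B) (fun a ha x hx => ?_) ht hρ
    (hasSum_evolve L t ρ)
  exact key a ha x hx

theorem hasDerivAt_evolve (L : Mat d →ₗ[ℂ] Mat d) (ρ : Mat d) (l : Mat d →ₗ[ℂ] ℂ) (t : ℝ) :
    HasDerivAt (fun s => l (evolve L s ρ)) (l (hsDual L (evolve L t ρ))) t :=
  hasDerivAt_of_hasSum_exp (E := Fin d → Fin d → ℂ) (A := hsDual L)
    (u := fun s => evolve L s ρ) (fun s => hasSum_evolve L s ρ) l t

theorem hasDerivAt_evolve_apply (L : Mat d →ₗ[ℂ] Mat d) (ρ : Mat d) (i j : Fin d) (t : ℝ) :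
    HasDerivAt (fun s => evolve L s ρ i j) (hsDual L (evolve L t ρ) i j) t :=
  hasDerivAt_evolve L ρ (entryLinearMap ℂ ℂ i j) t

theorem continuous_evolve (L : Mat d →ₗ[ℂ] Mat d) (ρ : Mat d) :
    Continuous fun t => evolve L t ρ :=
  continuous_matrix fun i j => continuous_iff_continuousAt.2 fun t =>
    (hasDerivAt_evolve_apply L ρ i j t).continuousAt

theorem evolve_zero (L : Mat d →ₗ[ℂ] Mat d) (ρ : Mat d) : evolve L 0 ρ = ρ := by
  refine (hasSum_evolve L 0 ρ).unique ?_
  convert hasSum_single 0 ?_ using 1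
  · simp
  · intro n hn
    simp [hn]

theorem evolve_of_hsDual_eq_zero {L : Mat d →ₗ[ℂ] Mat d} {σ : Mat d} (h : hsDual L σ = 0) (t : ℝ) :
    evolve L t σ = σ := by
  refine (hasSum_evolve L t σ).unique ?_
  convert hasSum_single 0 ?_ using 1
  · simp
  · intro n hn
    obtain ⟨k, rfl⟩ := Nat.exists_eq_succ_of_ne_zero hn
    have : (hsDual L ^ (k + 1)) σ = (hsDual L ^ k) (hsDual L σ) := by rw [pow_succ]; rfl
    rw [Nat.succ_eq_add_one, this, h, map_zero, smul_zero]

theorem trace_evolve {L : Mat d →ₗ[ℂ] Mat d} (hL : IsLiouvillian L) (ρ : Mat d) (t : ℝ) :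
    (evolve L t ρ).trace = ρ.trace := by
  have hd : ∀ s : ℝ, HasDerivAt (fun s => (evolve L s ρ).trace) 0 s := fun s => by
    have h := hasDerivAt_evolve L ρ (traceLinearMap (Fin d) ℂ ℂ) s
    rwa [traceLinearMap_apply, trace_hsDual hL] at h
  have h := is_const_of_deriv_eq_zero (fun s => (hd s).differentiableAt)
    (fun s => (hd s).deriv) t 0
  rwa [evolve_zero] at h

theorem evolve_add_smul (L : Mat d →ₗ[ℂ] Mat d) (t : ℝ) (a b : ℂ) (ρ σ : Mat d) :
    evolve L t (a • ρ + b • σ) = a • evolve L t ρ + b • evolve L t σ := by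
  refine (hasSum_evolve L t _).unique ?_
  convert ((hasSum_evolve L t ρ).const_smul a).add ((hasSum_evolve L t σ).const_smul b) using 2
  rw [map_add, map_smul, map_smul, smul_add, smul_comm a, smul_comm b]

/-! ### Exponential decay of variance and relative entropy along the evolution -/

/-- A Gronwall bound: `D' ≤ -2 c D` on `(0, ∞)` forces `D t ≤ exp (-c t)² D 0`. The rate `c` may
have any sign. -/
theorem le_exp_mul_of_hasDerivAt {D D' : ℝ → ℝ} {c : ℝ} (hcont : ContinuousOn D (Set.Ici 0))
    (hD : ∀ t, 0 < t → HasDerivAt D (D' t) t) (hle : ∀ t, 0 < t → D' t ≤ -(2 * (c * D t)))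
    {t : ℝ} (ht : 0 ≤ t) : D t ≤ Real.exp (-(c * t)) ^ 2 * D 0 := by
  have hd : ∀ t, 0 < t → HasDerivAt (fun s => Real.exp (2 * c * s) * D s)
      (Real.exp (2 * c * t) * (2 * c) * D t + Real.exp (2 * c * t) * D' t) t := fun t ht => by
    have h := (((hasDerivAt_id t).const_mul (2 * c)).exp).mul (hD t ht)
    refine h.congr_deriv ?_
    simp
  have hanti : AntitoneOn (fun s => Real.exp (2 * c * s) * D s) (Set.Ici 0) := by
    refine antitoneOn_of_deriv_nonpos (convex_Ici 0)
      ((by fun_prop : Continuous fun s : ℝ => Real.exp (2 * c * s)).continuousOn.mul hcont)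
      (fun v hv => ?_) (fun v hv => ?_)
    · rw [interior_Ici] at hv
      exact (hd v hv).differentiableAt.differentiableWithinAt
    · rw [interior_Ici] at hv
      rw [(hd v hv).deriv, mul_assoc, ← mul_add]
      refine mul_nonpos_of_nonneg_of_nonpos (Real.exp_pos _).le ?_
      linarith [hle v hv]
  have h := hanti Set.self_mem_Ici ht ht
  simp only [mul_zero, Real.exp_zero, one_mul] at h
  have e : Real.exp (-(c * t)) ^ 2 * Real.exp (2 * c * t) = 1 := by
    rw [← Real.exp_nat_mul, ← Real.exp_add]
    norm_num
    ring
  calc D t = Real.exp (-(c * t)) ^ 2 * (Real.exp (2 * c * t) * D t) := by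
        rw [← mul_assoc, e, one_mul]
    _ ≤ _ := mul_le_mul_of_nonneg_left h (sq_nonneg _)

theorem isState_evolve {L : Mat d →ₗ[ℂ] Mat d} (hL : IsLiouvillian L) {t : ℝ} (ht : 0 ≤ t)
    {ρ : Mat d} (hρ : IsState ρ) : IsState (evolve L t ρ) :=
  ⟨evolve_posSemidef hL ht hρ.1, by rw [trace_evolve hL, hρ.2]⟩

/-- The form `(A, B) ↦ tr (A Γ_σ⁻¹(B))` is symmetric. -/
theorem trace_mul_gamInv_comm (σ A B : Mat d) :
    (A * gamInv σ B).trace = (B * gamInv σ A).trace := by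
  rw [gamInv_apply, gamInv_apply, trace_mul_comm]
  simp only [Matrix.mul_assoc]
  rw [trace_mul_comm]
  simp only [Matrix.mul_assoc]

/-- Up to the constant `1`, this is the derivative of the variance of the relative density
`Γ_σ⁻¹(ρ_t)`. -/
theorem hasDerivAt_trace_mul_gamInv (L : Mat d →ₗ[ℂ] Mat d) (σ ρ : Mat d) (t : ℝ) :
    HasDerivAt (fun s => (evolve L s ρ * gamInv σ (evolve L s ρ)).trace.re)
      (2 * (evolve L t ρ * gamInv σ (hsDual L (evolve L t ρ))).trace.re) t := by
  have h : HasDerivAt (fun s => ∑ i, ∑ j, evolve L s ρ i j * gamInv σ (evolve L s ρ) j i)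
      (∑ i, ∑ j, (hsDual L (evolve L t ρ) i j * gamInv σ (evolve L t ρ) j i +
        evolve L t ρ i j * gamInv σ (hsDual L (evolve L t ρ)) j i)) t :=
    HasDerivAt.fun_sum fun i _ => HasDerivAt.fun_sum fun j _ =>
      (hasDerivAt_evolve_apply L ρ i j t).mul
        (hasDerivAt_evolve L ρ (entryLinearMap ℂ ℂ j i ∘ₗ gamInv σ) t)
  have h2 := Complex.reCLM.hasFDerivAt.comp_hasDerivAt t h
  have e : ∑ i, ∑ j, (hsDual L (evolve L t ρ) i j * gamInv σ (evolve L t ρ) j i +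
        evolve L t ρ i j * gamInv σ (hsDual L (evolve L t ρ)) j i) =
      2 * (evolve L t ρ * gamInv σ (hsDual L (evolve L t ρ))).trace := by
    rw [two_mul]
    nth_rewrite 1 [trace_mul_gamInv_comm]
    simp only [Finset.sum_add_distrib, Matrix.trace, diag_apply, mul_apply]
  rw [e] at h2
  have e2 : (2 * (evolve L t ρ * gamInv σ (hsDual L (evolve L t ρ))).trace.re) =
      Complex.reCLM (2 * (evolve L t ρ * gamInv σ (hsDual L (evolve L t ρ))).trace) := by
    simp
  rw [e2]
  refine h2.congr_of_eventuallyEq (Filter.Eventually.of_forall fun s => ?_)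
  simp only [Matrix.trace, diag_apply, mul_apply, Function.comp_apply, Complex.reCLM_apply]

theorem variance_gamInv {σ ρ : Mat d} (hσ : σ.PosDef) (hρ1 : ρ.trace = 1) :
    variance σ (gamInv σ ρ) = (ρ * gamInv σ ρ).trace.re - 1 := by
  rw [variance, gam_gamInv hσ, hρ1]
  norm_num

/-- The `χ²` divergence of `ρ` from `σ` is the variance of the relative density `Γ_σ⁻¹(ρ)`. -/
theorem trace_sub_mul_gamInv_sub {σ ρ : Mat d} (hσ : σ.PosDef) (hσ1 : σ.trace = 1)
    (hρ1 : ρ.trace = 1) :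
    ((ρ - σ) * gamInv σ (ρ - σ)).trace.re = (ρ * gamInv σ ρ).trace.re - 1 := by
  have h := trace_mul_gamInv_comm σ σ ρ
  rw [gamInv_self hσ, Matrix.mul_one, hρ1] at h
  rw [map_sub, Matrix.sub_mul, Matrix.mul_sub, Matrix.mul_sub, gamInv_self hσ, Matrix.mul_one,
    Matrix.mul_one, trace_sub, trace_sub, trace_sub, h, hρ1, hσ1]
  simp

theorem dirichlet2_gamInv {L : Mat d →ₗ[ℂ] Mat d} {σ : Mat d} (hσ : σ.PosDef) (ρ : Mat d) :
    dirichlet2 σ (hatGen L σ) (gamInv σ ρ) = -(ρ * gamInv σ (hsDual L ρ)).trace.re := by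
  rw [dirichlet2, hatGen, LinearMap.comp_apply, LinearMap.comp_apply, gam_gamInv hσ]

/-- The Poincaré inequality makes the `χ²` divergence from `σ` decay at rate `2 c`; it dominates
the squared trace norm and is initially at most `1 / σ_min`. -/
theorem trNorm_evolve_le_of_poincare {L : Mat d →ₗ[ℂ] Mat d} (hL : IsLiouvillian L)
    {σ : Mat d} (hσ : σ.PosDef) (hσ1 : σ.trace = 1) {c : ℝ}
    (hc : ∀ g : Mat d, g.IsHermitian → c * variance σ g ≤ dirichlet2 σ (hatGen L σ) g)
    {ρ : Mat d} (hρ : IsState ρ) {t : ℝ} (ht : 0 ≤ t) :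
    trNorm (evolve L t ρ - σ) ≤ √(1 / minEig hσ.isHermitian) * Real.exp (-(c * t)) := by
  have hst : ∀ s, 0 ≤ s → IsState (evolve L s ρ) := fun s hs => isState_evolve hL hs hρ
  have hd : ∀ s, HasDerivAt (fun s => (evolve L s ρ * gamInv σ (evolve L s ρ)).trace.re - 1)
      (2 * (evolve L s ρ * gamInv σ (hsDual L (evolve L s ρ))).trace.re) s := fun s =>
    (hasDerivAt_trace_mul_gamInv L σ ρ s).sub_const 1
  have hdecay := le_exp_mul_of_hasDerivAt (c := c)
    (fun s _ => (hd s).continuousAt.continuousWithinAt) (fun s _ => hd s) (fun s hs => by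
      have h := hc _ (gamInv_isHermitian (σ := σ) (hst s hs.le).1.isHermitian)
      rw [dirichlet2_gamInv hσ, variance_gamInv hσ (hst s hs.le).2] at h
      linarith) ht
  rw [evolve_zero] at hdecay
  have h0 := trace_mul_gamInv_le hσ hρ
  have hnorm := sq_trNorm_le_trace_mul_gamInv hσ hσ1
    ((hst t ht).1.isHermitian.sub hσ.isHermitian)
  rw [trace_sub_mul_gamInv_sub hσ hσ1 (hst t ht).2] at hnorm
  have : Nonempty (Fin d) := nonempty_of_trace_eq_one hσ1
  have hmin := minEig_pos hσ
  refine (le_abs_self _).trans (abs_le_of_sq_le_sq ?_ (by positivity))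
  rw [mul_pow, Real.sq_sqrt (by positivity), mul_comm]
  refine (hnorm.trans hdecay).trans (mul_le_mul_of_nonneg_left ?_ (sq_nonneg _))
  linarith

/-- Klein's inequality, here as a by-product of Pinsker's with the unitary `S = 1`. -/
theorem relEnt_nonneg {ρ τ : Mat d} (hρ : ρ.PosDef) (hτ : τ.PosDef) (hρ1 : ρ.trace = 1)
    (hτ1 : τ.trace = 1) : 0 ≤ (ρ * (mlog ρ - mlog τ)).trace.re := by
  have h := sq_trace_mul_sub_le (S := 1) hρ hτ hρ1 hτ1 conjTranspose_one (Matrix.one_mul 1)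
  linarith [sq_nonneg (1 * (ρ - τ)).trace.re]

/-- The relative entropy `ρ ↦ tr (ρ (log ρ - log σ))` lies above its tangents on states: the
difference of the two sides is the relative entropy of `ρ` with respect to `τ`. -/
theorem trace_sub_mul_le_relEnt_sub {ρ τ : Mat d} (σ : Mat d) (hρ : ρ.PosDef) (hτ : τ.PosDef)
    (hρ1 : ρ.trace = 1) (hτ1 : τ.trace = 1) :
    ((ρ - τ) * (mlog τ - mlog σ)).trace.re ≤
      (ρ * (mlog ρ - mlog σ)).trace.re - (τ * (mlog τ - mlog σ)).trace.re := by
  have h := relEnt_nonneg hρ hτ hρ1 hτ1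
  simp only [Matrix.mul_sub, Matrix.sub_mul, trace_sub, Complex.sub_re] at h ⊢
  linarith

open scoped Matrix.Norms.L2Operator in
/-- Continuity of the functional calculus is available in C⋆-algebras, so matrices carry the
operator norm here; its topology is the entrywise one. -/
theorem continuousOn_mlog {X : Type*} [TopologicalSpace X] {u : X → Mat d} {s : Set X}
    (hu : ContinuousOn u s) (hpos : ∀ x ∈ s, (u x).PosDef) :
    ContinuousOn (fun x => mlog (u x)) s := by
  refine ContinuousOn.cfc_of_mem_nhdsSet (s := {0}ᶜ) Real.log ?_ hu
    (fun x hx => (hpos x hx).isHermitian.isSelfAdjoint) Real.continuousOn_log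
  refine isOpen_compl_singleton.mem_nhdsSet.2 (Set.iUnion₂_subset fun x hx y hy => ?_)
  rw [(hpos x hx).isHermitian.spectrum_real_eq_range_eigenvalues] at hy
  obtain ⟨i, rfl⟩ := hy
  exact ((hpos x hx).eigenvalues_pos i).ne'

theorem tendsto_slope_trace_mul (L : Mat d →ₗ[ℂ] Mat d) (ρ : Mat d) {t : ℝ} {Y : ℝ → Mat d}
    {Z : Mat d} (hY : Filter.Tendsto Y (nhdsWithin t {t}ᶜ) (nhds Z)) :
    Filter.Tendsto (fun s => (s - t)⁻¹ * ((evolve L s ρ - evolve L t ρ) * Y s).trace.re)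
      (nhdsWithin t {t}ᶜ) (nhds (hsDual L (evolve L t ρ) * Z).trace.re) := by
  have h : Filter.Tendsto (fun s => (∑ i, ∑ j, slope (fun s => evolve L s ρ i j) t s * Y s j i).re)
      (nhdsWithin t {t}ᶜ) (nhds (∑ i, ∑ j, hsDual L (evolve L t ρ) i j * Z j i).re) := by
    refine (Complex.continuous_re.tendsto _).comp
      (tendsto_finsetSum _ fun i _ => tendsto_finsetSum _ fun j _ => ?_)
    refine (hasDerivAt_iff_tendsto_slope.1 (hasDerivAt_evolve_apply L ρ i j t)).mul ?_
    exact (((continuous_id.matrix_elem j i).tendsto Z).comp hY)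
  simp only [Matrix.trace, diag_apply, mul_apply] at h ⊢
  refine h.congr fun s => ?_
  simp only [slope_def_module, Matrix.sub_apply, smul_mul_assoc, ← Finset.smul_sum,
    Complex.smul_re, smul_eq_mul]

/-- The derivative of the relative entropy along the evolution. No derivative of the matrix
logarithm is needed: by convexity the difference quotient at `s` lies between the quotients of
`tr ((ρ_s - ρ_t) (log ρ_t - log σ))` and `tr ((ρ_s - ρ_t) (log ρ_s - log σ))`, and these have a
common limit because the logarithm is continuous. -/
theorem hasDerivAt_relEnt {L : Mat d →ₗ[ℂ] Mat d} (hL : IsLiouvillian L) (σ : Mat d)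
    {ρ : Mat d} (hρ1 : ρ.trace = 1) (hpos : ∀ s, 0 ≤ s → (evolve L s ρ).PosDef)
    {t : ℝ} (ht : 0 < t) :
    HasDerivAt (fun s => (evolve L s ρ * (mlog (evolve L s ρ) - mlog σ)).trace.re)
      (hsDual L (evolve L t ρ) * (mlog (evolve L t ρ) - mlog σ)).trace.re t := by
  have htr : ∀ s, (evolve L s ρ).trace = 1 := fun s => by rw [trace_evolve hL, hρ1]
  have hY : Filter.Tendsto (fun s => mlog (evolve L s ρ) - mlog σ) (nhdsWithin t {t}ᶜ)
      (nhds (mlog (evolve L t ρ) - mlog σ)) := by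
    have h := (continuousOn_mlog (continuous_evolve L ρ).continuousOn hpos).continuousAt
      (Ici_mem_nhds ht)
    exact (h.tendsto.mono_left nhdsWithin_le_nhds).sub_const _
  have ha := tendsto_slope_trace_mul L ρ (t := t)
    (tendsto_const_nhds (x := mlog (evolve L t ρ) - mlog σ))
  have hb := tendsto_slope_trace_mul L ρ hY
  rw [hasDerivAt_iff_tendsto_slope]
  have hmin := ha.min hb
  have hmax := ha.max hb
  rw [min_self] at hmin
  rw [max_self] at hmax
  have hev : ∀ᶠ s in nhdsWithin t {t}ᶜ, 0 < s :=
    nhdsWithin_le_nhds (Ioi_mem_nhds ht)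
  have hcmp : ∀ s, 0 < s → ((evolve L s ρ - evolve L t ρ) *
        (mlog (evolve L t ρ) - mlog σ)).trace.re ≤
        (evolve L s ρ * (mlog (evolve L s ρ) - mlog σ)).trace.re -
          (evolve L t ρ * (mlog (evolve L t ρ) - mlog σ)).trace.re ∧
      (evolve L s ρ * (mlog (evolve L s ρ) - mlog σ)).trace.re -
          (evolve L t ρ * (mlog (evolve L t ρ) - mlog σ)).trace.re ≤
        ((evolve L s ρ - evolve L t ρ) * (mlog (evolve L s ρ) - mlog σ)).trace.re := by
    intro s hs
    have h1 := trace_sub_mul_le_relEnt_sub σ (hpos s hs.le) (hpos t ht.le) (htr s) (htr t)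
    have h2 := trace_sub_mul_le_relEnt_sub σ (hpos t ht.le) (hpos s hs.le) (htr t) (htr s)
    rw [← neg_sub (evolve L s ρ), Matrix.neg_mul, trace_neg, Complex.neg_re] at h2
    exact ⟨h1, by linarith⟩
  refine tendsto_of_tendsto_of_tendsto_of_le_of_le' hmin hmax
    (hev.mono fun s hs => ?_) (hev.mono fun s hs => ?_)
  all_goals
    obtain ⟨h1, h2⟩ := hcmp s hs
    rw [slope_def_module, smul_eq_mul]
    rcases le_total t s with hst | hst
  · exact (min_le_left _ _).trans
      (mul_le_mul_of_nonneg_left h1 (inv_nonneg.2 (sub_nonneg.2 hst)))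
  · exact (min_le_right _ _).trans
      (mul_le_mul_of_nonpos_left h2 (inv_nonpos.2 (sub_nonpos.2 hst)))
  · exact le_max_of_le_right
      (mul_le_mul_of_nonneg_left h2 (inv_nonneg.2 (sub_nonneg.2 hst)))
  · exact le_max_of_le_left
      (mul_le_mul_of_nonpos_left h1 (inv_nonpos.2 (sub_nonpos.2 hst)))

theorem ent1_gamInv {σ ρ : Mat d} (hσ : σ.PosDef) (hρ1 : ρ.trace = 1) :
    ent1 σ (gamInv σ ρ) = (ρ * (mlog ρ - mlog σ)).trace.re := by
  rw [ent1, gam_gamInv hσ, hρ1]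
  simp

theorem dirichlet1_gamInv {L : Mat d →ₗ[ℂ] Mat d} {σ : Mat d} (hσ : σ.PosDef) (ρ : Mat d) :
    dirichlet1 σ (hatGen L σ) (gamInv σ ρ) =
      -(1 / 2) * (hsDual L ρ * (mlog ρ - mlog σ)).trace.re := by
  rw [dirichlet1, hatGen, LinearMap.comp_apply, LinearMap.comp_apply, gam_gamInv hσ,
    gam_gamInv hσ]

/-- Under the log-Sobolev inequality the relative entropy decays at rate `2 c`, as long as the
evolved state stays positive definite. -/
theorem relEnt_evolve_le {L : Mat d →ₗ[ℂ] Mat d} (hL : IsLiouvillian L)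
    {σ : Mat d} (hσ : σ.PosDef) {c : ℝ}
    (hc : ∀ f : Mat d, f.PosDef → c * ent1 σ f ≤ dirichlet1 σ (hatGen L σ) f)
    {ρ : Mat d} (hρ1 : ρ.trace = 1) (hpos : ∀ s, 0 ≤ s → (evolve L s ρ).PosDef)
    {t : ℝ} (ht : 0 ≤ t) :
    (evolve L t ρ * (mlog (evolve L t ρ) - mlog σ)).trace.re ≤
      Real.exp (-(c * t)) ^ 2 * (ρ * (mlog ρ - mlog σ)).trace.re := by
  have hcont : ContinuousOn
      (fun s => (evolve L s ρ * (mlog (evolve L s ρ) - mlog σ)).trace.re) (Set.Ici 0) := by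
    have h1 := continuousOn_mlog (continuous_evolve L ρ).continuousOn hpos
    have h2 := (continuous_evolve L ρ).continuousOn (s := Set.Ici 0)
    exact Complex.continuous_re.comp_continuousOn ((continuous_id.matrix_trace).comp_continuousOn
      (h2.mul (h1.sub continuousOn_const)))
  have h := le_exp_mul_of_hasDerivAt (c := c) hcont
    (fun s hs => hasDerivAt_relEnt hL σ hρ1 hpos hs) (fun s hs => by
      have h := hc _ (gamInv_posDef hσ (hpos s hs.le))
      rw [dirichlet1_gamInv hσ, ent1_gamInv hσ (by rw [trace_evolve hL, hρ1])] at h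
      linarith) ht
  simpa only [evolve_zero] using h

/-- Decay of relative entropy and Pinsker's inequality, for the full-rank states
`(1 - ε) ρ + ε σ`; their evolution is `(1 - ε) ρ_t + ε σ`, and `ε → 0` gives the bound for `ρ`. -/
theorem trNorm_evolve_le_of_logSobolev {L : Mat d →ₗ[ℂ] Mat d} (hL : IsLiouvillian L)
    {σ : Mat d} (hσ : σ.PosDef) (hσ1 : σ.trace = 1) (hσL : hsDual L σ = 0) {c : ℝ}
    (hc : ∀ f : Mat d, f.PosDef → c * ent1 σ f ≤ dirichlet1 σ (hatGen L σ) f)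
    {ρ : Mat d} (hρ : IsState ρ) {t : ℝ} (ht : 0 ≤ t) :
    trNorm (evolve L t ρ - σ) ≤
      √(2 * Real.log (1 / minEig hσ.isHermitian)) * Real.exp (-(c * t)) := by
  obtain ⟨S, hS, hSS, hS1⟩ := exists_trNorm_eq
    ((evolve_posSemidef hL ht hρ.1).isHermitian.sub hσ.isHermitian)
  set B := √(2 * Real.log (1 / minEig hσ.isHermitian)) * Real.exp (-(c * t)) with hB
  have hB0 : 0 ≤ B := by positivity
  have key : ∀ ε : ℝ, 0 < ε → ε < 1 → (1 - ε) * trNorm (evolve L t ρ - σ) ≤ B := by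
    intro ε hε hε1
    have hε' : (0 : ℂ) < (ε : ℂ) := by exact_mod_cast hε
    have hε1' : (0 : ℂ) ≤ ((1 - ε : ℝ) : ℂ) := by exact_mod_cast (sub_pos.2 hε1).le
    set τ : Mat d := ((1 - ε : ℝ) : ℂ) • ρ + (ε : ℂ) • σ with hτ
    have hev : ∀ s, evolve L s τ = ((1 - ε : ℝ) : ℂ) • evolve L s ρ + (ε : ℂ) • σ := fun s => by
      rw [hτ, evolve_add_smul, evolve_of_hsDual_eq_zero hσL]
    have hpos : ∀ s, 0 ≤ s → (evolve L s τ).PosDef := fun s hs => by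
      rw [hev]
      exact PosDef.posSemidef_add ((evolve_posSemidef hL hs hρ.1).smul hε1') (hσ.smul hε')
    have hτ1 : τ.trace = 1 := by
      rw [hτ, trace_add, trace_smul, trace_smul, hρ.2, hσ1]
      simp
    have hτpos : τ.PosDef := by simpa only [evolve_zero] using hpos 0 le_rfl
    have hsub : evolve L t τ - σ = ((1 - ε : ℝ) : ℂ) • (evolve L t ρ - σ) := by
      rw [hev, smul_sub, Complex.ofReal_sub, Complex.ofReal_one, sub_smul 1 (ε : ℂ) σ, one_smul]
      abel
    -- `S` attains the trace norm of `ρ_t - σ`, hence also that of `(1 - ε) (ρ_t - σ)`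
    have h1 := sq_trace_mul_sub_le (hpos t ht) hσ (by rw [trace_evolve hL, hτ1]) hσ1 hS hSS
    have h2 := relEnt_evolve_le hL hσ hc hτ1 hpos ht
    have h3 := relEnt_le hτpos hσ hτ1
    have h4 := relEnt_nonneg hτpos hσ hτ1 hσ1
    have e : (S * (evolve L t τ - σ)).trace.re = (1 - ε) * trNorm (evolve L t ρ - σ) := by
      rw [hsub, mul_smul_comm, trace_smul, hS1, smul_eq_mul, Complex.re_ofReal_mul]
    rw [e] at h1
    refine (le_abs_self _).trans (abs_le_of_sq_le_sq ?_ hB0)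
    have h5 : 0 ≤ 2 * Real.log (1 / minEig hσ.isHermitian) := by linarith
    rw [hB, mul_pow (√_), Real.sq_sqrt h5]
    calc ((1 - ε) * trNorm (evolve L t ρ - σ)) ^ 2
        ≤ 2 * (Real.exp (-(c * t)) ^ 2 * (τ * (mlog τ - mlog σ)).trace.re) := by linarith
      _ ≤ 2 * (Real.exp (-(c * t)) ^ 2 * Real.log (1 / minEig hσ.isHermitian)) := by gcongr
      _ = _ := by ring
  have hlim : Filter.Tendsto (fun ε : ℝ => (1 - ε) * trNorm (evolve L t ρ - σ))
      (nhdsWithin 0 (Set.Ioi 0)) (nhds (trNorm (evolve L t ρ - σ))) := by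
    have hc : Continuous fun ε : ℝ => (1 - ε) * trNorm (evolve L t ρ - σ) := by fun_prop
    have := (hc.tendsto 0).mono_left (nhdsWithin_le_nhds (s := Set.Ioi (0 : ℝ)))
    simpa using this
  refine le_of_tendsto hlim ?_
  filter_upwards [Ioo_mem_nhdsGT (zero_lt_one (α := ℝ))] with ε hε
  exact key ε hε.1 hε.2

end QMix

theorem theorem4p2 {d : ℕ} (L : QMix.Mat d →ₗ[ℂ] QMix.Mat d)
    (hL : QMix.IsLiouvillian L) (hprim : QMix.IsPrimitive L)
    (σ : QMix.Mat d) (hσ : QMix.IsStationaryState L σ) :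
    (∀ lam : ℝ,
      (∀ g : QMix.Mat d, g.IsHermitian →
        lam * QMix.variance σ g ≤ QMix.dirichlet2 σ (QMix.hatGen L σ) g) →
      ∀ ρ : QMix.Mat d, QMix.IsState ρ → ∀ t : ℝ, 0 ≤ t →
        QMix.trNorm (QMix.evolve L t ρ - σ) ≤
          Real.sqrt (1 / QMix.minEig hσ.1.1.isHermitian) * Real.exp (-(lam * t))) ∧
    (∀ α : ℝ,
      (∀ f : QMix.Mat d, f.PosDef →
        α * QMix.ent1 σ f ≤ QMix.dirichlet1 σ (QMix.hatGen L σ) f) →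
      ∀ ρ : QMix.Mat d, QMix.IsState ρ → ∀ t : ℝ, 0 ≤ t →
        QMix.trNorm (QMix.evolve L t ρ - σ) ≤
          Real.sqrt (2 * Real.log (1 / QMix.minEig hσ.1.1.isHermitian)) *
            Real.exp (-(α * t))) := by
  have hpos : σ.PosDef := by
    obtain ⟨σ', -, hσ', huniq⟩ := hprim
    rwa [huniq σ hσ]
  exact ⟨fun c hc ρ hρ t ht => QMix.trNorm_evolve_le_of_poincare hL hpos hσ.1.2 hc hρ ht,
    fun c hc ρ hρ t ht => QMix.trNorm_evolve_le_of_logSobolev hL hpos hσ.1.2 hσ.2 hc hρ ht⟩
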